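/- Let $n\ge 1$ and $A\in\mathbb C^{n\times n}$; write $\Lambda(M)$ for the set of eigenvalues of a matrix $M$, $\alpha(M)=\max\{\mathrm{Re}\,z : z\in\Lambda(M)\}$ for its spectral abscissa, $\|\cdot\|_F$ for the Frobenius norm, $\langle F,G\rangle=\mathrm{trace}(F^*G)$, $B_r(c)$ for the open disk of radius $r$ around $c$, and for $\epsilon>0$ $$\Lambda_\epsilon(A)=\bigcup_{\|\Delta\|_F\le\epsilon}\Lambda(A+\Delta),\qquad \alpha_\epsilon(A)=\max\{\mathrm{Re}\,z : z\in\Lambda_\epsilon(A)\}.$$ Let $U\subset\mathbb R$ be an open interval containing $0$ such that for every $\mu_0\in\Lambda(A)$ there is a real $r(\mu_0)>0$ such that, for every $\eta\in U$ and every $\Delta\in\mathbb C^{n\times n}$ with $\|\Delta\|_F\le1$, the matrix $A+\eta\Delta$ has exactly one eigenvalue in $B_{r(\mu_0)}(\mu_0)$, and this eigenvalue is simple; denote it by $\mu(\eta;\Delta,\mu_0)$. For $\epsilon>0$ with $[0,\epsilon]\subset U$ put $\widetilde{\mathcal R}(\epsilon;\mu_0)=\max_{\|\Delta\|_F\le1}\mathrm{Re}\,\mu(\epsilon;\Delta,\mu_0)$.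 For each $\mu_0\in\Lambda(A)$ let $x_{\mu_0}$, $y_{\mu_0}$ be a unit right and a unit left eigenvector of $A$ for $\mu_0$ with $y_{\mu_0}^*x_{\mu_0}$ real and positive, and let $x(\eta;\mu_0)$, $y(\eta;\mu_0)$, $\eta\in U$, be real-analytic functions whose values are unit right and unit left eigenvectors of $A+\eta\,y_{\mu_0}x_{\mu_0}^*$ for the eigenvalue $\mu(\eta;y_{\mu_0}x_{\mu_0}^*,\mu_0)$, with $y(\eta;\mu_0)^*x(\eta;\mu_0)$ real and positive, $x(0;\mu_0)=x_{\mu_0}$ and $y(0;\mu_0)=y_{\mu_0}$. Let $h=h(\epsilon)>0$ with $h=\mathcal O(\epsilon)$ as $\epsilon\to0^+$, and put $$\widetilde x_p^{\mu_0}=\frac{x(h;\mu_0)-x_{\mu_0}}h,\qquad \widetilde y_p^{\mu_0}=\frac{y(h;\mu_0)-y_{\mu_0}}h,\qquad \widetilde\beta_p^{\mu_0}=\frac{-1}{y_{\mu_0}^*x_{\mu_0}}\left\{(\widetilde y_p^{\mu_0})^*x_{\mu_0}+y_{\mu_0}^*\widetilde x_p^{\mu_0}\right\},$$ $$G^{\mu_0}=y_{\mu_0}x_{\mu_0}^*+\frac\epsilon2\left\{\widetilde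 y_p^{\mu_0}x_{\mu_0}^*+y_{\mu_0}(\widetilde x_p^{\mu_0})^*+\widetilde\beta_p^{\mu_0}\,y_{\mu_0}x_{\mu_0}^*\right\},\qquad \widetilde\Delta_*^{\mu_0}=\frac{G^{\mu_0}}{\|G^{\mu_0}\|_F}.$$ Then, for every $\epsilon>0$ with $[0,\epsilon]\subset U$, the maxima defining $\alpha_\epsilon(A)$ and $\widetilde{\mathcal R}(\epsilon;\mu_0)$ are attained and $$\alpha_\epsilon(A)=\max_{\mu_0\in\Lambda(A)}\widetilde{\mathcal R}(\epsilon;\mu_0).$$ Moreover, for all sufficiently small $\epsilon>0$ one has $h\in U$ and $G^{\mu_0}\ne0$ for every $\mu_0\in\Lambda(A)$, and as $\epsilon\to0^+$ $$\alpha_\epsilon(A)=\max_{\mu_0\in\Lambda(A)}\mathrm{Re}\,\mu(\epsilon;\widetilde\Delta_*^{\mu_0},\mu_0)+\mathcal O(\epsilon^3)=\max_{\mu_0\in\Lambda(A)}\alpha\big(A+\epsilon\widetilde\Delta_*^{\mu_0}\big)+\mathcal O(\epsilon^3)$$ $$=\max_{\mu_0\in\Lambda(A)}\left\{\mathrm{Re}\,\mu_0+\frac{\epsilon}{y_{\mu_0}^*x_{\mu_0}}\mathrm{Re}\,\big\langle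 G^{\mu_0},\widetilde\Delta_*^{\mu_0}\big\rangle\right\}+\mathcal O(\epsilon^3).$$ -/

import Mathlib

open Filter Topology Asymptotics
open scoped Matrix Matrix.Norms.Frobenius

noncomputable section

namespace PsaMatrix

/-- Complex column vectors of length `n` with the Euclidean norm and `inner ℂ y x = y^* x`. -/
abbrev Vec (n : ℕ) := EuclideanSpace ℂ (Fin n)

/-- Square complex matrices of size `n`; the norm `‖M‖` is the Frobenius norm
(opened as a scoped instance above), and `spectrum ℂ M` is the set of eigenvalues. -/
abbrev Mat (n : ℕ) := Matrix (Fin n) (Fin n) ℂ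

/-- The rank-one matrix `u v^*`. -/
def outer {n : ℕ} (u v : Vec n) : Mat n :=
  Matrix.vecMulVec u.ofLp (star v.ofLp)

/-- The inner product `⟨F, G⟩ = trace (F^* G)`. -/
def frobInner {n : ℕ} (F G : Mat n) : ℂ :=
  (Fᴴ * G).trace

/-- The maximum of `f` over the (finite) set of eigenvalues of `A`. -/
def maxEig {n : ℕ} (A : Mat n) (f : ℂ → ℝ) : ℝ :=
  sSup (f '' spectrum ℂ A)

/-- For matrices of positive size `maxEig` is an attained maximum. -/
theorem isGreatest_maxEig {n : ℕ} (hn : 1 ≤ n) (A : Mat n) (f : ℂ → ℝ) :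
    IsGreatest (f '' spectrum ℂ A) (maxEig A f) := by
  have : Nonempty (Fin n) := ⟨⟨0, hn⟩⟩
  have hne : (spectrum ℂ A).Nonempty := spectrum.nonempty_of_isAlgClosed_of_finiteDimensional ℂ A
  have hfin : (spectrum ℂ A).Finite := Matrix.finite_spectrum A
  exact ⟨(hne.image f).csSup_mem (hfin.image f), fun _ hb => le_csSup (hfin.image f).bddAbove hb⟩

/-- The spectral abscissa: the largest real part of an eigenvalue. -/
def spectralAbscissa {n : ℕ} (A : Mat n) : ℝ :=
  maxEig A Complex.re

/-- The `ε`-pseudospectrum with respect to the Frobenius norm. -/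
def pseudospectrum {n : ℕ} (ε : ℝ) (A : Mat n) : Set ℂ :=
  ⋃ Δ ∈ {Δ : Mat n | ‖Δ‖ ≤ ε}, spectrum ℂ (A + Δ)

/-- The `ε`-pseudospectral abscissa: the largest real part of a point of the
`ε`-pseudospectrum. -/
def psAbscissa {n : ℕ} (ε : ℝ) (A : Mat n) : ℝ :=
  sSup (Complex.re '' pseudospectrum ε A)

/-- `M` has only one eigenvalue in the open ball `B_r(c)`, and this eigenvalue is simple
(a root of multiplicity one of the characteristic polynomial). -/
def HasOneSimpleEig {n : ℕ} (M : Mat n) (c : ℂ) (r : ℝ) : Prop :=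
  ∃ z : ℂ, spectrum ℂ M ∩ Metric.ball c r = {z} ∧ M.charpoly.rootMultiplicity z = 1

/-- `μ(η; Δ, μ₀)`: the eigenvalue of `A + η Δ` in the ball `B_r(μ₀)`. It is only used where
this eigenvalue exists and is unique. -/
def eigBranch {n : ℕ} (A : Mat n) (r : ℝ) (μ₀ : ℂ) (Δ : Mat n) (η : ℝ) : ℂ :=
  Classical.epsilon fun z : ℂ => z ∈ spectrum ℂ (A + (η : ℂ) • Δ) ∩ Metric.ball μ₀ r

/-- The real parts of the eigenvalues that can be attained from `μ₀` by perturbations `ε Δ`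
with `‖Δ‖_F ≤ 1`. -/
def attainable {n : ℕ} (A : Mat n) (r : ℝ) (ε : ℝ) (μ₀ : ℂ) : Set ℝ :=
  (fun Δ : Mat n => (eigBranch A r μ₀ Δ ε).re) '' {Δ : Mat n | ‖Δ‖ ≤ 1}

/-- The maximum over `‖Δ‖_F ≤ 1` of `Re μ(ε; Δ, μ₀)`. -/
def maxBranch {n : ℕ} (A : Mat n) (r : ℝ) (ε : ℝ) (μ₀ : ℂ) : ℝ :=
  sSup (attainable A r ε μ₀)

/-- `x`, `y` are unit right and unit left eigenvectors of `M` for the eigenvalue `μ`, and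
`y^* x` is real and positive. -/
structure IsNormalizedEigenpair {n : ℕ} (M : Mat n) (μ : ℂ) (x y : Vec n) : Prop where
  norm_right : ‖x‖ = 1
  norm_left : ‖y‖ = 1
  right : M *ᵥ x.ofLp = μ • x.ofLp
  left : star y.ofLp ᵥ* M = μ • star y.ofLp
  im_eq : (inner ℂ y x).im = 0
  re_pos : 0 < (inner ℂ y x).re

/-- `X`, `Y` are analytic curves of unit right and unit left eigenvectors of `A + η Δ`, `η ∈ U`,
for the eigenvalue `μ(η; Δ, μ₀)`, with `Y(η)^* X(η)` real and positive, that start at `x` and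
`y`. -/
structure IsEigenvectorCurves {n : ℕ} (A : Mat n) (r : ℝ) (U : Set ℝ) (μ₀ : ℂ) (Δ : Mat n)
    (x y : Vec n) (X Y : ℝ → Vec n) : Prop where
  analytic_right : AnalyticOnNhd ℝ X U
  analytic_left : AnalyticOnNhd ℝ Y U
  eigenpair : ∀ η ∈ U,
    IsNormalizedEigenpair (A + (η : ℂ) • Δ) (eigBranch A r μ₀ Δ η) (X η) (Y η)
  start_right : X 0 = x
  start_left : Y 0 = y

/-- The finite difference `(X(h) - x) / h`. -/
def finDiff {n : ℕ} (x : Vec n) (X : ℝ → Vec n) (h : ℝ) : Vec n :=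
  (h : ℂ)⁻¹ • (X h - x)

/-- The scalar `-(ỹ_p^* x + y^* x̃_p) / (y^* x)`. -/
def betaP {n : ℕ} (x y : Vec n) (X Y : ℝ → Vec n) (h : ℝ) : ℂ :=
  -1 / inner ℂ y x * (inner ℂ (finDiff y Y h) x + inner ℂ y (finDiff x X h))

/-- The matrix `y x^* + (ε / 2) (ỹ_p x^* + y x̃_p^* + β̃_p y x^*)`. -/
def corrected {n : ℕ} (x y : Vec n) (X Y : ℝ → Vec n) (ε h : ℝ) : Mat n :=
  outer y x + ((ε : ℂ) / 2) •
    (outer (finDiff y Y h) x + outer y (finDiff x X h) + betaP x y X Y h • outer y x)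

/-- The near-optimal perturbation: `corrected` divided by its Frobenius norm. -/
def nearOpt {n : ℕ} (x y : Vec n) (X Y : ℝ → Vec n) (ε h : ℝ) : Mat n :=
  ((‖corrected x y X Y ε h‖ : ℂ))⁻¹ • corrected x y X Y ε h

/-- The explicit second-order expression
`Re μ₀ + ε / (y^* x) * Re ⟨corrected, nearOpt⟩`. -/
def secondOrder {n : ℕ} (μ₀ : ℂ) (x y : Vec n) (X Y : ℝ → Vec n) (ε h : ℝ) : ℝ :=
  μ₀.re + ε / (inner ℂ y x).re *
    (frobInner (corrected x y X Y ε h) (nearOpt x y X Y ε h)).re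

end PsaMatrix

end

/-!
Two facts carry the proof.

*The branches exhaust the perturbed spectrum.* All eigenvalues of `A` are simple, so there are `n`
of them. Each eigenvalue in a ball `B_r(μ₀)` depends continuously on the matrix, because the modulus
of the characteristic polynomial at a point bounds a power of the distance to the nearest eigenvalue
(`eventually_exists_mem_spectrum`, `continuousOn_ballEig`). Two branches cannot meet along
`[0, ε]`, even if their balls overlap: uniqueness in the open balls makes the set where they agree
open as well as closed (`ballEig_ne_of_ne`). Hence the `n` branches at `A + ε Δ` are all of its
eigenvalues (`HasBranches.exists_eq_eigBranch`), and compactness of the unit ball gives the attained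
maxima and the exact identity for `α_ε(A)`.

*The direction `D = y x^*` is optimal up to `O(ε³)`, and this is stable.* Let `ν` and `μ` be the
branch eigenvalues in directions `Δ` and `D`. With a right eigenvector `u` for `ν` and the left
eigenvector `Y = Y(ε)` for `μ` one has exactly `(ν - μ) Y^* u = ε Y^* (Δ - D) u`. Since `u` and `Y`
are within `O(ε)` of `x` and `y`, uniformly in `Δ`, this reads
`(ν - μ) (y^* x) = ε ⟨D, Δ - D⟩ + O(ε² ‖Δ - D‖)`
(`HasBranches.exists_norm_eigBranch_sub_le`). In the unit ball
`Re ⟨D, Δ - D⟩ ≤ - ‖Δ - D‖² / 2`, with equality on the sphere. So no `Δ` gains more than `O(ε³)`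
over `D` (`HasBranches.maxBranch_sub_isBigO`), and every unit `Δ` with `Δ - D = O(ε)`, such as
`nearOpt`, is as good as `D` up to `O(ε³)` (`HasBranches.eigBranch_sub_isBigO`).

It remains to expand `Re μ` and `‖G‖`, for `G` the matrix `corrected`. Pairing the eigenvalue
equations of the curves with `y` and `x` gives
`μ - μ₀ = ε (x^* X) / (y^* X) = ε (Y^* y) / (Y^* x)`. As `X` and `Y` are curves of unit vectors,
`x^* X` and `Y^* y` have real part `1 + O(ε²)`, and averaging the two quotients yields
`Re μ = Re μ₀ + ε / (y^* x) (1 + (ε / 2) Re β) + O(ε³)` with `β` the scalar `betaP`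
(`IsEigenvectorCurves.eigBranch_sub_isBigO`). The same orthogonality gives
`‖G‖ = 1 + (ε / 2) Re β + O(ε²)` (`IsEigenvectorCurves.norm_corrected_sub_isBigO`), and the
expression `secondOrder` is `Re μ₀ + ε / (y^* x) ‖G‖`.
-/

noncomputable section

namespace PsaMatrix

/-! ### Eigenvalues as functions of the matrix -/

theorem card_roots_charpoly {n : ℕ} (M : Mat n) : M.charpoly.roots.card = n := by
  rw [← (IsAlgClosed.splits M.charpoly).natDegree_eq_card_roots,
    Matrix.charpoly_natDegree_eq_dim, Fintype.card_fin]

/-- The modulus of the characteristic polynomial at `z` is the product of the distances from `z`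
to the eigenvalues, so a small value forces an eigenvalue close to `z`. -/
theorem pow_le_norm_eval_charpoly {n : ℕ} (M : Mat n) (z : ℂ) {δ : ℝ} (hδ : 0 ≤ δ)
    (h : ∀ w ∈ spectrum ℂ M, δ ≤ ‖z - w‖) : δ ^ n ≤ ‖M.charpoly.eval z‖ := by
  have hs : M.charpoly.Splits := IsAlgClosed.splits _
  have key : ∀ s : Multiset ℂ, (∀ w ∈ s, δ ≤ ‖z - w‖) →
      δ ^ s.card ≤ ‖(s.map fun w => z - w).prod‖ := by
    intro s
    induction s using Multiset.induction_on with
    | empty => simp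
    | cons a s ih =>
      intro hw
      rw [Multiset.card_cons, Multiset.map_cons, Multiset.prod_cons, norm_mul, pow_succ']
      exact mul_le_mul (hw a (Multiset.mem_cons_self a s))
        (ih fun w hws => hw w (Multiset.mem_cons_of_mem hws)) (pow_nonneg hδ _) (norm_nonneg _)
  rw [hs.eval_eq_prod_roots_of_monic M.charpoly_monic]
  conv_lhs => rw [← card_roots_charpoly M]
  refine key _ fun w hw => h w ?_
  rw [Matrix.mem_spectrum_iff_isRoot_charpoly]
  exact (Polynomial.mem_roots'.1 hw).2

/-- Lower semicontinuity of the spectrum. -/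
theorem eventually_exists_mem_spectrum {n : ℕ} {M₀ : Mat n} {z : ℂ} (hz : z ∈ spectrum ℂ M₀)
    {δ : ℝ} (hδ : 0 < δ) : ∀ᶠ M in 𝓝 M₀, ∃ w ∈ spectrum ℂ M, ‖z - w‖ < δ := by
  have hc : Continuous fun M : Mat n => ‖M.charpoly.eval z‖ := by
    simp_rw [Matrix.eval_charpoly]
    fun_prop
  have h0 : ‖M₀.charpoly.eval z‖ = 0 := by
    rw [Matrix.mem_spectrum_iff_isRoot_charpoly] at hz
    rw [hz.eq_zero, norm_zero]
  have : ∀ᶠ M in 𝓝 M₀, ‖M.charpoly.eval z‖ < δ ^ n :=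
    hc.continuousAt.eventually_lt continuousAt_const (by rw [h0]; positivity)
  filter_upwards [this] with M hM
  by_contra! hcon
  exact absurd (pow_le_norm_eval_charpoly M z hδ.le hcon) (not_le.2 hM)

/-- The eigenvalue of `M` in the ball `B_r(c)`, meaningful where it exists and is unique; the
branch `μ(η; Δ, μ₀)` is its value at `A + η Δ`. -/
def ballEig {n : ℕ} (c : ℂ) (r : ℝ) (M : Mat n) : ℂ :=
  Classical.epsilon fun z : ℂ => z ∈ spectrum ℂ M ∩ Metric.ball c r

theorem eigBranch_eq_ballEig {n : ℕ} (A : Mat n) (r : ℝ) (c : ℂ) (Δ : Mat n) (η : ℝ) :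
    eigBranch A r c Δ η = ballEig c r (A + (η : ℂ) • Δ) := rfl

theorem HasOneSimpleEig.ballEig_mem {n : ℕ} {M : Mat n} {c : ℂ} {r : ℝ}
    (h : HasOneSimpleEig M c r) : ballEig c r M ∈ spectrum ℂ M ∩ Metric.ball c r := by
  obtain ⟨z, hz, -⟩ := h
  exact Classical.epsilon_spec (p := fun z : ℂ => z ∈ spectrum ℂ M ∩ Metric.ball c r)
    ⟨z, hz ▸ rfl⟩

theorem HasOneSimpleEig.eq_ballEig {n : ℕ} {M : Mat n} {c : ℂ} {r : ℝ}
    (h : HasOneSimpleEig M c r) {w : ℂ} (hw : w ∈ spectrum ℂ M) (hw' : w ∈ Metric.ball c r) :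
    w = ballEig c r M := by
  have hm := h.ballEig_mem
  obtain ⟨z, hz, -⟩ := h
  rw [hz] at hm
  have : w ∈ ({z} : Set ℂ) := hz ▸ ⟨hw, hw'⟩
  exact this.trans hm.symm

theorem HasOneSimpleEig.rootMultiplicity_ballEig {n : ℕ} {M : Mat n} {c : ℂ} {r : ℝ}
    (h : HasOneSimpleEig M c r) : M.charpoly.rootMultiplicity (ballEig c r M) = 1 := by
  have hm := h.ballEig_mem
  obtain ⟨z, hz, h1⟩ := h
  rw [hz] at hm
  rwa [show ballEig c r M = z from hm]

theorem continuousOn_ballEig {n : ℕ} (c : ℂ) (r : ℝ) :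
    ContinuousOn (ballEig c r) {M : Mat n | HasOneSimpleEig M c r} := by
  intro M₀ hM₀
  obtain ⟨hs, hb⟩ := HasOneSimpleEig.ballEig_mem hM₀
  rw [ContinuousWithinAt, Metric.tendsto_nhds]
  intro δ hδ
  obtain ⟨ρ, hρ, hρb⟩ := Metric.isOpen_iff.1 Metric.isOpen_ball _ hb
  filter_upwards [(eventually_exists_mem_spectrum hs (lt_min hδ hρ)).filter_mono
    nhdsWithin_le_nhds, self_mem_nhdsWithin] with M hM hMs
  obtain ⟨w, hw, hwd⟩ := hM
  have hwd' : dist w (ballEig c r M₀) < min δ ρ := by rwa [dist_comm, dist_eq_norm]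
  have hwb : w ∈ Metric.ball c r := hρb (hwd'.trans_le (min_le_right _ _))
  rw [← HasOneSimpleEig.eq_ballEig hMs hw hwb]
  exact hwd'.trans_le (min_le_left _ _)

/-- Two branches over an interval that agree at one point agree everywhere: where they agree, the
common value lies in both open balls, and uniqueness keeps them together nearby. -/
theorem ballEig_ne_of_ne {n : ℕ} {c₁ c₂ : ℂ} {r₁ r₂ : ℝ} {S : Set ℝ} (hS : IsPreconnected S)
    {γ : ℝ → Mat n} (hγ : ContinuousOn γ S) (h₁ : ∀ t ∈ S, HasOneSimpleEig (γ t) c₁ r₁)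
    (h₂ : ∀ t ∈ S, HasOneSimpleEig (γ t) c₂ r₂) {a b : ℝ} (ha : a ∈ S) (hb : b ∈ S)
    (hab : ballEig c₁ r₁ (γ a) ≠ ballEig c₂ r₂ (γ a)) :
    ballEig c₁ r₁ (γ b) ≠ ballEig c₂ r₂ (γ b) := by
  have k₁ : ContinuousOn (fun t => ballEig c₁ r₁ (γ t)) S :=
    (continuousOn_ballEig c₁ r₁).comp hγ h₁
  have k₂ : ContinuousOn (fun t => ballEig c₂ r₂ (γ t)) S :=
    (continuousOn_ballEig c₂ r₂).comp hγ h₂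
  let p : ℝ → Prop := fun t => ballEig c₁ r₁ (γ t) = ballEig c₂ r₂ (γ t)
  have hloc : ∀ t ∈ S, ∀ᶠ s in 𝓝[S] t, (p s ↔ p t) := by
    intro t ht
    by_cases hp : p t
    · have hmem : ballEig c₂ r₂ (γ t) ∈ Metric.ball c₁ r₁ := by
        rw [← hp]; exact (h₁ t ht).ballEig_mem.2
      filter_upwards [(k₂ t ht).eventually (Metric.isOpen_ball.mem_nhds hmem),
        self_mem_nhdsWithin] with s hs hsS
      exact iff_of_true
        ((h₁ s hsS).eq_ballEig (h₂ s hsS).ballEig_mem.1 hs).symm hp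
    · filter_upwards [((k₁ t ht).sub (k₂ t ht)).eventually_ne (sub_ne_zero.2 hp)] with s hs
      exact iff_of_false (sub_ne_zero.1 hs) hp
  have hcont : ContinuousOn (fun t => decide (p t)) S := by
    intro t ht
    refine tendsto_pure.2 ?_ |>.mono_right (pure_le_nhds _)
    filter_upwards [hloc t ht] with s hs
    simp [hs]
  have := hS.constant hcont ha hb
  simp only [decide_eq_decide, p] at this
  exact fun h => hab (this.2 h)

/-- On `U` and the unit ball of perturbations, each ball `B_{r(μ₀)}(μ₀)` around an eigenvalue of
`A` holds exactly one eigenvalue of `A + η Δ`, and this eigenvalue is simple. -/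
def HasBranches {n : ℕ} (A : Mat n) (U : Set ℝ) (r : ℂ → ℝ) : Prop :=
  ∀ μ₀ ∈ spectrum ℂ A, ∀ η ∈ U, ∀ Δ : Mat n, ‖Δ‖ ≤ 1 →
    HasOneSimpleEig (A + (η : ℂ) • Δ) μ₀ (r μ₀)

theorem HasBranches.hasOneSimpleEig_self {n : ℕ} {A : Mat n} {U : Set ℝ} {r : ℂ → ℝ}
    (hr : HasBranches A U r) (hU0 : (0 : ℝ) ∈ U) {μ₀ : ℂ} (hμ : μ₀ ∈ spectrum ℂ A) :
    HasOneSimpleEig A μ₀ (r μ₀) := by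
  simpa using hr μ₀ hμ 0 hU0 0 (by simp)

theorem HasBranches.ballEig_self {n : ℕ} {A : Mat n} {U : Set ℝ} {r : ℂ → ℝ}
    (hr : HasBranches A U r) (hU0 : (0 : ℝ) ∈ U) {μ₀ : ℂ} (hμ : μ₀ ∈ spectrum ℂ A)
    (hrpos : 0 < r μ₀) : ballEig μ₀ (r μ₀) A = μ₀ :=
  ((hr.hasOneSimpleEig_self hU0 hμ).eq_ballEig hμ (Metric.mem_ball_self hrpos)).symm

theorem HasBranches.rootMultiplicity_eq_one {n : ℕ} {A : Mat n} {U : Set ℝ} {r : ℂ → ℝ}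
    (hr : HasBranches A U r) (hU0 : (0 : ℝ) ∈ U) {μ₀ : ℂ} (hμ : μ₀ ∈ spectrum ℂ A)
    (hrpos : 0 < r μ₀) : A.charpoly.rootMultiplicity μ₀ = 1 := by
  have := (hr.hasOneSimpleEig_self hU0 hμ).rootMultiplicity_ballEig
  rwa [hr.ballEig_self hU0 hμ hrpos] at this

theorem mem_spectrum_iff_mem_roots {n : ℕ} (M : Mat n) (z : ℂ) :
    z ∈ spectrum ℂ M ↔ z ∈ M.charpoly.roots.toFinset := by
  rw [Matrix.mem_spectrum_iff_isRoot_charpoly, Multiset.mem_toFinset,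
    Polynomial.mem_roots M.charpoly_monic.ne_zero]

/-- The branches exhaust the spectrum: the `n` simple eigenvalues of `A` start branches that stay
distinct, and `A + ε Δ` has at most `n` eigenvalues. -/
theorem HasBranches.exists_eq_eigBranch {n : ℕ} {A : Mat n} {U : Set ℝ} {r : ℂ → ℝ}
    (hr : HasBranches A U r) (hrpos : ∀ μ₀ ∈ spectrum ℂ A, 0 < r μ₀) {ε : ℝ} (hε : 0 < ε)
    (hU : Set.Icc 0 ε ⊆ U) {Δ : Mat n} (hΔ : ‖Δ‖ ≤ 1) {w : ℂ}
    (hw : w ∈ spectrum ℂ (A + (ε : ℂ) • Δ)) :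
    ∃ μ₀ ∈ spectrum ℂ A, eigBranch A (r μ₀) μ₀ Δ ε = w := by
  have hU0 : (0 : ℝ) ∈ U := hU ⟨le_rfl, hε.le⟩
  have hεU : ε ∈ U := hU ⟨hε.le, le_rfl⟩
  have hnodup : A.charpoly.roots.Nodup := by
    rw [Multiset.nodup_iff_count_le_one]
    intro z
    by_cases hz : z ∈ A.charpoly.roots
    · have hz' : z ∈ spectrum ℂ A := by
        rw [mem_spectrum_iff_mem_roots, Multiset.mem_toFinset]; exact hz
      rw [Polynomial.count_roots, hr.rootMultiplicity_eq_one hU0 hz' (hrpos z hz')]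
    · rw [Multiset.count_eq_zero_of_notMem hz]; exact zero_le_one
  have hmaps : Set.MapsTo (fun μ₀ => eigBranch A (r μ₀) μ₀ Δ ε) A.charpoly.roots.toFinset
      (A + (ε : ℂ) • Δ).charpoly.roots.toFinset := by
    intro μ₀ hμ
    have hμ' := (mem_spectrum_iff_mem_roots A μ₀).2 hμ
    exact (mem_spectrum_iff_mem_roots _ _).1 (hr μ₀ hμ' ε hεU Δ hΔ).ballEig_mem.1
  have hinj : Set.InjOn (fun μ₀ => eigBranch A (r μ₀) μ₀ Δ ε) A.charpoly.roots.toFinset := by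
    intro μ₁ hμ₁ μ₂ hμ₂ heq
    have hμ₁' := (mem_spectrum_iff_mem_roots A μ₁).2 hμ₁
    have hμ₂' := (mem_spectrum_iff_mem_roots A μ₂).2 hμ₂
    by_contra hne
    refine ballEig_ne_of_ne (S := Set.Icc 0 ε) isPreconnected_Icc
      (γ := fun t => A + (t : ℂ) • Δ) (by fun_prop)
      (fun t ht => hr μ₁ hμ₁' t (hU ht) Δ hΔ) (fun t ht => hr μ₂ hμ₂' t (hU ht) Δ hΔ)
      (a := 0) (b := ε) ⟨le_rfl, hε.le⟩ ⟨hε.le, le_rfl⟩ ?_ heq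
    simpa [hr.ballEig_self hU0 hμ₁' (hrpos _ hμ₁'), hr.ballEig_self hU0 hμ₂' (hrpos _ hμ₂')]
      using hne
  have hcard : (A + (ε : ℂ) • Δ).charpoly.roots.toFinset.card ≤
      A.charpoly.roots.toFinset.card := by
    rw [Multiset.toFinset_card_of_nodup hnodup, card_roots_charpoly]
    exact (Multiset.toFinset_card_le _).trans (card_roots_charpoly _).le
  obtain ⟨μ₀, hμ₀, hw'⟩ := Finset.surjOn_of_injOn_of_card_le _ hmaps hinj hcard
    ((mem_spectrum_iff_mem_roots _ w).1 hw)
  exact ⟨μ₀, (mem_spectrum_iff_mem_roots A μ₀).2 hμ₀, hw'⟩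

/-- The maximum of a branch over the unit ball of perturbations is attained, by compactness. -/
theorem HasBranches.isGreatest_maxBranch {n : ℕ} {A : Mat n} {U : Set ℝ} {r : ℂ → ℝ}
    (hr : HasBranches A U r) {ε : ℝ} (hε : ε ∈ U) {μ₀ : ℂ} (hμ : μ₀ ∈ spectrum ℂ A) :
    IsGreatest (attainable A (r μ₀) ε μ₀) (maxBranch A (r μ₀) ε μ₀) := by
  have hball : {Δ : Mat n | ‖Δ‖ ≤ 1} = Metric.closedBall 0 1 := by
    ext; simp
  have : ProperSpace (Mat n) := FiniteDimensional.proper ℂ _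
  have hK : IsCompact {Δ : Mat n | ‖Δ‖ ≤ 1} := hball ▸ isCompact_closedBall _ _
  have hcont : ContinuousOn (fun Δ : Mat n => (eigBranch A (r μ₀) μ₀ Δ ε).re)
      {Δ : Mat n | ‖Δ‖ ≤ 1} :=
    Complex.continuous_re.comp_continuousOn
      ((continuousOn_ballEig μ₀ (r μ₀)).comp (f := fun Δ : Mat n => A + (ε : ℂ) • Δ)
        (by fun_prop) fun Δ hΔ => hr μ₀ hμ ε hε Δ hΔ)
  exact (hK.image_of_continuousOn hcont).isGreatest_sSup ⟨_, 0, by simp, rfl⟩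

theorem mem_pseudospectrum_iff {n : ℕ} {A : Mat n} {ε : ℝ} (hε : 0 < ε) {w : ℂ} :
    w ∈ pseudospectrum ε A ↔ ∃ Δ : Mat n, ‖Δ‖ ≤ 1 ∧ w ∈ spectrum ℂ (A + (ε : ℂ) • Δ) := by
  simp only [pseudospectrum, Set.mem_iUnion, Set.mem_ofPred_eq, exists_prop]
  have hε' : (ε : ℂ) ≠ 0 := by exact_mod_cast hε.ne'
  constructor
  · rintro ⟨Δ, hΔ, hw⟩
    refine ⟨(ε : ℂ)⁻¹ • Δ, ?_, by rwa [smul_inv_smul₀ hε']⟩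
    rw [norm_smul, norm_inv, Complex.norm_real, Real.norm_of_nonneg hε.le, inv_mul_le_iff₀ hε]
    simpa using hΔ
  · rintro ⟨Δ, hΔ, hw⟩
    refine ⟨(ε : ℂ) • Δ, ?_, hw⟩
    rw [norm_smul, Complex.norm_real, Real.norm_of_nonneg hε.le]
    nlinarith

/-- The `ε`-pseudospectral abscissa is attained, as the largest of the branch maxima. -/
theorem HasBranches.isGreatest_maxEig_maxBranch {n : ℕ} (hn : 1 ≤ n) {A : Mat n} {U : Set ℝ}
    {r : ℂ → ℝ} (hr : HasBranches A U r) (hrpos : ∀ μ₀ ∈ spectrum ℂ A, 0 < r μ₀) {ε : ℝ}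
    (hε : 0 < ε) (hU : Set.Icc 0 ε ⊆ U) :
    IsGreatest (Complex.re '' pseudospectrum ε A)
      (maxEig A fun μ₀ => maxBranch A (r μ₀) ε μ₀) := by
  have hεU : ε ∈ U := hU ⟨hε.le, le_rfl⟩
  obtain ⟨⟨μ₀, hμ₀, hmax⟩, hub⟩ := isGreatest_maxEig hn A fun μ₀ => maxBranch A (r μ₀) ε μ₀
  constructor
  · obtain ⟨Δ, hΔ, hre⟩ := (hr.isGreatest_maxBranch hεU hμ₀).1
    refine ⟨eigBranch A (r μ₀) μ₀ Δ ε, (mem_pseudospectrum_iff hε).2 ⟨Δ, hΔ, ?_⟩, hre.trans hmax⟩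
    exact (hr μ₀ hμ₀ ε hεU Δ hΔ).ballEig_mem.1
  · rintro _ ⟨w, hw, rfl⟩
    obtain ⟨Δ, hΔ, hw⟩ := (mem_pseudospectrum_iff hε).1 hw
    obtain ⟨μ₁, hμ₁, rfl⟩ := hr.exists_eq_eigBranch hrpos hε hU hΔ hw
    exact ((hr.isGreatest_maxBranch hεU hμ₁).2 ⟨Δ, hΔ, rfl⟩).trans (hub ⟨μ₁, hμ₁, rfl⟩)

/-! ### Matrices acting on Euclidean vectors and the Frobenius inner product -/

/-- The matrix `M` as an operator on Euclidean vectors. -/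
abbrev act {n : ℕ} (M : Mat n) : Vec n →L[ℂ] Vec n := Matrix.toEuclideanCLM (𝕜 := ℂ) M

theorem norm_act_le {n : ℕ} (M : Mat n) (v : Vec n) : ‖act M v‖ ≤ ‖M‖ * ‖v‖ := by
  have h := Matrix.frobenius_norm_mul M (Matrix.replicateCol Unit v.ofLp)
  rw [Matrix.frobenius_norm_replicateCol, ← Matrix.replicateCol_mulVec,
    Matrix.frobenius_norm_replicateCol] at h
  exact h

theorem norm_inner_act_le {n : ℕ} (y : Vec n) (M : Mat n) (v : Vec n) :
    ‖inner ℂ y (act M v)‖ ≤ ‖y‖ * ‖M‖ * ‖v‖ := by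
  calc ‖inner ℂ y (act M v)‖ ≤ ‖y‖ * ‖act M v‖ := norm_inner_le_norm _ _
    _ ≤ ‖y‖ * (‖M‖ * ‖v‖) := by gcongr; exact norm_act_le M v
    _ = _ := by ring

theorem act_outer {n : ℕ} (u v w : Vec n) : act (outer u v) w = inner ℂ v w • u := by
  ext i
  simp only [act, Matrix.ofLp_toEuclideanCLM, outer, Matrix.vecMulVec_mulVec,
    EuclideanSpace.inner_eq_star_dotProduct, PiLp.smul_apply]
  simp [dotProduct_comm, mul_comm]

theorem IsNormalizedEigenpair.act_right {n : ℕ} {M : Mat n} {μ : ℂ} {x y : Vec n}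
    (h : IsNormalizedEigenpair M μ x y) : act M x = μ • x := by
  ext i
  exact congrFun h.right i

theorem IsNormalizedEigenpair.inner_act {n : ℕ} {M : Mat n} {μ : ℂ} {x y : Vec n}
    (h : IsNormalizedEigenpair M μ x y) (v : Vec n) :
    inner ℂ y (act M v) = μ * inner ℂ y v := by
  rw [EuclideanSpace.inner_eq_star_dotProduct, EuclideanSpace.inner_eq_star_dotProduct,
    dotProduct_comm, dotProduct_comm v.ofLp, Matrix.ofLp_toEuclideanCLM,
    Matrix.dotProduct_mulVec, h.left, smul_dotProduct, smul_eq_mul]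

theorem IsNormalizedEigenpair.inner_eq {n : ℕ} {M : Mat n} {μ : ℂ} {x y : Vec n}
    (h : IsNormalizedEigenpair M μ x y) : inner ℂ y x = ((inner ℂ y x).re : ℂ) :=
  Complex.ext rfl (by simpa using h.im_eq)

theorem frobInner_outer_left {n : ℕ} (u v : Vec n) (E : Mat n) :
    frobInner (outer u v) E = inner ℂ u (act E v) := by
  rw [EuclideanSpace.inner_eq_star_dotProduct, Matrix.ofLp_toEuclideanCLM, frobInner, outer,
    Matrix.conjTranspose_vecMulVec, star_star, Matrix.vecMulVec_mul, Matrix.trace_vecMulVec,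
    dotProduct_comm, ← Matrix.dotProduct_mulVec, dotProduct_comm]

theorem frobInner_add_right {n : ℕ} (F G H : Mat n) :
    frobInner F (G + H) = frobInner F G + frobInner F H := by
  simp [frobInner, mul_add]

theorem frobInner_smul_right {n : ℕ} (c : ℂ) (F G : Mat n) :
    frobInner F (c • G) = c * frobInner F G := by
  simp [frobInner]

theorem frobInner_eq_sum {n : ℕ} (F G : Mat n) :
    frobInner F G = ∑ i, ∑ j, inner ℂ (F i j) (G i j) := by
  rw [Finset.sum_comm]
  simp [frobInner, Matrix.trace, Matrix.mul_apply, mul_comm]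

theorem norm_sq_eq_sum {n : ℕ} (F : Mat n) : ‖F‖ ^ 2 = ∑ i, ∑ j, ‖F i j‖ ^ 2 := by
  rw [Matrix.frobenius_norm_def, ← Real.sqrt_eq_rpow, Real.sq_sqrt (by positivity)]
  norm_cast

theorem frobInner_self {n : ℕ} (F : Mat n) : frobInner F F = ((‖F‖ ^ 2 : ℝ) : ℂ) := by
  rw [frobInner_eq_sum, norm_sq_eq_sum]
  simp [inner_self_eq_norm_sq_to_K]

theorem norm_add_sq_frobenius {n : ℕ} (F G : Mat n) :
    ‖F + G‖ ^ 2 = ‖F‖ ^ 2 + 2 * (frobInner F G).re + ‖G‖ ^ 2 := by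
  simp only [norm_sq_eq_sum, frobInner_eq_sum, Complex.re_sum, Finset.mul_sum,
    ← Finset.sum_add_distrib, Matrix.add_apply]
  refine Finset.sum_congr rfl fun i _ => Finset.sum_congr rfl fun j _ => ?_
  exact norm_add_sq (𝕜 := ℂ) (F i j) (G i j)

theorem norm_outer {n : ℕ} (u v : Vec n) : ‖outer u v‖ = ‖u‖ * ‖v‖ := by
  have h := frobInner_self (outer u v)
  rw [frobInner_outer_left, act_outer, inner_smul_right, inner_self_eq_norm_sq_to_K,
    inner_self_eq_norm_sq_to_K] at h
  have h' : ‖v‖ ^ 2 * ‖u‖ ^ 2 = ‖outer u v‖ ^ 2 := by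
    apply Complex.ofReal_injective
    rw [← h]
    push_cast
    rfl
  refine (sq_eq_sq₀ (norm_nonneg _) (by positivity)).1 ?_
  rw [← h']; ring

/-! ### First-order control of eigenvectors -/

/-- At a simple eigenvalue, `A - μ₀` is bounded below on the orthogonal complement of the left
eigenvector. -/
theorem IsNormalizedEigenpair.exists_norm_le {n : ℕ} {A : Mat n} {μ₀ : ℂ} {x y : Vec n}
    (h : IsNormalizedEigenpair A μ₀ x y) (hs : A.charpoly.rootMultiplicity μ₀ = 1) :
    ∃ K : ℝ, 0 < K ∧ ∀ w : Vec n, inner ℂ y w = 0 → ‖w‖ ≤ K * ‖act A w - μ₀ • w‖ := by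
  have hxne : x ≠ 0 := fun h0 => by simpa [h0] using h.norm_right
  have hyx : inner ℂ y x ≠ 0 := fun h0 => by simpa [h0] using h.re_pos
  have hfin : Module.finrank ℂ (Module.End.eigenspace (Matrix.toLin' A) μ₀) ≤ 1 := by
    have := LinearMap.finrank_eigenspace_le (Matrix.toLin' A) μ₀
    rwa [Matrix.charpoly_toLin', hs] at this
  -- Adding the rank-one operator `x y^*` makes `A - μ₀` injective.
  let T : Vec n →L[ℂ] Vec n := act A - μ₀ • ContinuousLinearMap.id ℂ (Vec n) + act (outer x y)
  have hT : ∀ w, T w = act A w - μ₀ • w + inner ℂ y w • x := fun w => by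
    simp only [T, add_apply, sub_apply,
      smul_apply, ContinuousLinearMap.id_apply, act_outer]
  have hker : LinearMap.ker (T : Vec n →ₗ[ℂ] Vec n) = ⊥ := by
    refine LinearMap.ker_eq_bot'.2 fun w hw => ?_
    replace hw : act A w - μ₀ • w + inner ℂ y w • x = 0 := (hT w).symm.trans hw
    have h1 : inner ℂ y w = 0 := by
      have := congrArg (inner ℂ y) hw
      rw [inner_add_right, inner_sub_right, h.inner_act, inner_smul_right, inner_smul_right,
        sub_self, zero_add, inner_zero_right] at this
      exact (mul_eq_zero.1 this).resolve_right hyx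
    rw [h1, zero_smul, add_zero, sub_eq_zero] at hw
    have hwm : w.ofLp ∈ Module.End.eigenspace (Matrix.toLin' A) μ₀ := by
      rw [Module.End.mem_eigenspace_iff, Matrix.toLin'_apply]
      exact congrArg WithLp.ofLp hw
    have hxm : x.ofLp ∈ Module.End.eigenspace (Matrix.toLin' A) μ₀ := by
      rw [Module.End.mem_eigenspace_iff, Matrix.toLin'_apply]
      exact h.right
    obtain ⟨v, hv⟩ := finrank_le_one_iff.1 hfin
    obtain ⟨a, ha⟩ := hv ⟨_, hxm⟩
    obtain ⟨b, hb⟩ := hv ⟨_, hwm⟩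
    have ha0 : a ≠ 0 := by
      rintro rfl
      apply hxne
      have := congrArg Subtype.val ha
      ext i
      simpa using (congrFun this i).symm
    have hwx : w = (b * a⁻¹) • x := by
      have e1 := congrArg Subtype.val ha
      have e2 := congrArg Subtype.val hb
      ext i
      have e1 := congrFun e1 i
      have e2 := congrFun e2 i
      simp only [Submodule.coe_smul, Pi.smul_apply, smul_eq_mul] at e1 e2
      rw [PiLp.smul_apply, smul_eq_mul, ← e1, ← e2]
      field_simp
    rw [hwx, inner_smul_right] at h1
    rw [hwx, (mul_eq_zero.1 h1).resolve_right hyx, zero_smul]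
  obtain ⟨K, hK, hanti⟩ := LinearMap.exists_antilipschitzWith (T : Vec n →ₗ[ℂ] Vec n) hker
  refine ⟨K, hK, fun w hw => ?_⟩
  have := hanti.le_mul_norm (map_zero _) w
  rw [ContinuousLinearMap.coe_coe, hT, hw, zero_smul, add_zero] at this
  exact this

/-- For small `ε`, every eigenvalue of `A + ε Δ` close to `μ₀` has an eigenvector within `C ε` of
`x`, with `C` independent of `Δ` in the unit ball. It is scaled so that its difference from `x` is
orthogonal to `y`, where `A - μ₀` is bounded below. -/
theorem IsNormalizedEigenpair.exists_eigenvector_norm_sub_le {n : ℕ} {A : Mat n} {μ₀ : ℂ}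
    {x y : Vec n} (h : IsNormalizedEigenpair A μ₀ x y)
    (hs : A.charpoly.rootMultiplicity μ₀ = 1) :
    ∃ C ρ : ℝ, 0 < C ∧ 0 < ρ ∧ ∀ ε : ℝ, 0 < ε → ε ≤ ρ → ∀ Δ : Mat n, ‖Δ‖ ≤ 1 →
      ∀ ν ∈ spectrum ℂ (A + (ε : ℂ) • Δ), ‖ν - μ₀‖ ≤ ρ →
        ∃ u : Vec n, act (A + (ε : ℂ) • Δ) u = ν • u ∧ ‖u - x‖ ≤ C * ε := by
  obtain ⟨K, hK, hbd⟩ := h.exists_norm_le hs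
  obtain ⟨p, hpdef⟩ : ∃ p : ℝ, p = (inner ℂ y x).re := ⟨_, rfl⟩
  have hp : 0 < p := hpdef ▸ h.re_pos
  have hyx : inner ℂ y x = (p : ℂ) := hpdef ▸ h.inner_eq
  have hp' : (p : ℂ) ≠ 0 := by exact_mod_cast hp.ne'
  -- With radius `1 / (4 K)` both `|ν - μ₀|` and `ε` are small enough for `K (|ν - μ₀| + ε) ≤ 1/2`.
  refine ⟨2 * K * (2 / p + 1), 1 / (4 * K), by positivity, by positivity, ?_⟩
  intro ε hε hερ Δ hΔ ν hν hνρ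
  have hεn : ‖(ε : ℂ)‖ = ε := by rw [Complex.norm_real, Real.norm_of_nonneg hε.le]
  have hsmall : K * (‖ν - μ₀‖ + ε) ≤ 1 / 2 := by
    calc K * (‖ν - μ₀‖ + ε) ≤ K * (1 / (4 * K) + 1 / (4 * K)) := by gcongr
      _ = 1 / 2 := by field_simp; norm_num
  have hact : ∀ v, act (A + (ε : ℂ) • Δ) v = act A v + (ε : ℂ) • act Δ v := fun v => by
    simp only [act, map_add, map_smul, add_apply, smul_apply]
  have hΔv : ∀ v : Vec n, ‖act Δ v‖ ≤ ‖v‖ := fun v =>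
    (norm_act_le Δ v).trans (mul_le_of_le_one_left (norm_nonneg v) hΔ)
  have hres : ∀ u, act (A + (ε : ℂ) • Δ) u = ν • u →
      ‖act A u - μ₀ • u‖ ≤ (‖ν - μ₀‖ + ε) * ‖u‖ := fun u hu => by
    have e : act A u - μ₀ • u = (ν - μ₀) • u - (ε : ℂ) • act Δ u := by
      rw [hact] at hu
      rw [sub_smul, ← hu]; abel
    rw [e, add_mul]
    refine (norm_sub_le _ _).trans ?_
    rw [norm_smul, norm_smul, hεn]
    gcongr
    exact hΔv u
  obtain ⟨v, hv0, hv⟩ : ∃ v : Vec n, v ≠ 0 ∧ act (A + (ε : ℂ) • Δ) v = ν • v := by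
    have hev : Module.End.HasEigenvalue (Matrix.toLin' (A + (ε : ℂ) • Δ)) ν := by
      rwa [Module.End.hasEigenvalue_iff_mem_spectrum, Matrix.spectrum_toLin']
    obtain ⟨v, hv⟩ := hev.exists_hasEigenvector
    refine ⟨WithLp.toLp 2 v, by simpa using hv.2, ?_⟩
    ext i
    simpa using congrFun hv.apply_eq_smul i
  -- An eigenvector orthogonal to `y` would have at most half its own norm.
  have hyv : inner ℂ y v ≠ 0 := by
    intro h0
    have h1 := (hbd v h0).trans (mul_le_mul_of_nonneg_left (hres v hv) hK.le)
    have h2 : 0 < ‖v‖ := norm_pos_iff.2 hv0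
    nlinarith
  obtain ⟨u, hu, hyu⟩ : ∃ u : Vec n, act (A + (ε : ℂ) • Δ) u = ν • u ∧ inner ℂ y u = (p : ℂ) := by
    refine ⟨((p : ℂ) / inner ℂ y v) • v, ?_, ?_⟩
    · rw [map_smul, hv, smul_comm]
    · rw [inner_smul_right, div_mul_cancel₀ _ hyv]
  have hyw : inner ℂ y (u - x) = 0 := by rw [inner_sub_right, hyu, hyx, sub_self]
  have hw : ‖u - x‖ ≤ K * ((‖ν - μ₀‖ + ε) * ‖u‖) := by
    have e : act A (u - x) - μ₀ • (u - x) = act A u - μ₀ • u := by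
      rw [map_sub, h.act_right, smul_sub]; abel
    have := hbd _ hyw
    rw [e] at this
    exact this.trans (mul_le_mul_of_nonneg_left (hres u hu) hK.le)
  have hux : ‖u‖ ≤ ‖u - x‖ + 1 := by
    calc ‖u‖ = ‖(u - x) + x‖ := by rw [sub_add_cancel]
      _ ≤ ‖u - x‖ + ‖x‖ := norm_add_le _ _
      _ = _ := by rw [h.norm_right]
  have hs0 : 0 ≤ K * (‖ν - μ₀‖ + ε) := by positivity
  have hw2 : ‖u - x‖ ≤ 2 * (K * (‖ν - μ₀‖ + ε)) := by
    nlinarith [mul_le_mul_of_nonneg_left hux hs0, norm_nonneg (u - x),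
      mul_le_mul_of_nonneg_right hsmall (norm_nonneg (u - x))]
  have hu2 : ‖u‖ ≤ 2 := by linarith
  -- Pairing the eigenvalue equation with `y` bounds the eigenvalue shift.
  have hshift : ‖ν - μ₀‖ ≤ 2 * ε / p := by
    have e : (ν - μ₀) * p = ε * inner ℂ y (act Δ u) := by
      have := congrArg (inner ℂ y) hu
      rw [hact, inner_add_right, h.inner_act, inner_smul_right, inner_smul_right, hyu] at this
      linear_combination -this
    have e' : ‖ν - μ₀‖ * p ≤ ε * 2 := by
      have := congrArg norm e
      rw [norm_mul, norm_mul, hεn, Complex.norm_real, Real.norm_of_nonneg hp.le] at this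
      rw [this]
      gcongr
      refine (norm_inner_le_norm _ _).trans ?_
      rw [h.norm_left, one_mul]
      exact (hΔv u).trans hu2
    rw [le_div_iff₀ hp]; linarith
  refine ⟨u, hu, hw2.trans ?_⟩
  calc 2 * (K * (‖ν - μ₀‖ + ε)) ≤ 2 * (K * (2 * ε / p + ε)) := by gcongr
    _ = _ := by ring

/-- First-order comparison of two eigenvalues: if `d` is the difference of eigenvalues of two
matrices that differ by `ε E`, so that `d (Y^* u) = ε Y^* E u` for a left eigenvector `Y` of one
and a right eigenvector `u` of the other, then replacing `Y` and `u` by their limits costs only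
`O(ε² ‖E‖)`. -/
theorem norm_mul_sub_inner_act_le {n : ℕ} {x y u Y : Vec n} {p C ε : ℝ} {d : ℂ} {E : Mat n}
    (hx : ‖x‖ = 1) (hy : ‖y‖ = 1) (hyx : inner ℂ y x = (p : ℂ)) (hp : 0 < p) (hC : 0 < C)
    (hε : 0 < ε) (hε1 : C * ε ≤ 1) (hε2 : 3 * C * ε ≤ p / 2) (hY1 : ‖Y‖ = 1)
    (hu : ‖u - x‖ ≤ C * ε) (hY : ‖Y - y‖ ≤ C * ε)
    (hd : d * inner ℂ Y u = ε * inner ℂ Y (act E u)) :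
    ‖d * p - ε * inner ℂ y (act E x)‖ ≤ (3 * C + 12 * C / p) * ε ^ 2 * ‖E‖ := by
  have hεn : ‖(ε : ℂ)‖ = ε := by rw [Complex.norm_real, Real.norm_of_nonneg hε.le]
  have hu2 : ‖u‖ ≤ 2 := by
    calc ‖u‖ = ‖(u - x) + x‖ := by rw [sub_add_cancel]
      _ ≤ ‖u - x‖ + ‖x‖ := norm_add_le _ _
      _ ≤ 2 := by rw [hx]; linarith
  have h1 : ‖inner ℂ Y u - p‖ ≤ 3 * C * ε := by
    have e : inner ℂ Y u - p = inner ℂ (Y - y) u + inner ℂ y (u - x) := by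
      rw [← hyx, inner_sub_left, inner_sub_right]; ring
    rw [e]
    calc _ ≤ ‖inner ℂ (Y - y) u‖ + ‖inner ℂ y (u - x)‖ := norm_add_le _ _
      _ ≤ ‖Y - y‖ * ‖u‖ + ‖y‖ * ‖u - x‖ :=
        add_le_add (norm_inner_le_norm _ _) (norm_inner_le_norm _ _)
      _ ≤ C * ε * 2 + 1 * (C * ε) := by rw [hy]; gcongr
      _ = _ := by ring
  have h2 : ‖inner ℂ Y (act E u) - inner ℂ y (act E x)‖ ≤ 3 * C * ε * ‖E‖ := by
    have e : inner ℂ Y (act E u) - inner ℂ y (act E x) =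
        inner ℂ (Y - y) (act E u) + inner ℂ y (act E (u - x)) := by
      rw [inner_sub_left, map_sub, inner_sub_right]; ring
    rw [e]
    calc _ ≤ ‖inner ℂ (Y - y) (act E u)‖ + ‖inner ℂ y (act E (u - x))‖ := norm_add_le _ _
      _ ≤ ‖Y - y‖ * ‖E‖ * ‖u‖ + ‖y‖ * ‖E‖ * ‖u - x‖ :=
        add_le_add (norm_inner_act_le _ _ _) (norm_inner_act_le _ _ _)
      _ ≤ C * ε * ‖E‖ * 2 + 1 * ‖E‖ * (C * ε) := by rw [hy]; gcongr
      _ = _ := by ring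
  have h3 : ‖d‖ ≤ 4 * ε * ‖E‖ / p := by
    have hlow : p / 2 ≤ ‖inner ℂ Y u‖ := by
      have := norm_sub_norm_le (p : ℂ) (inner ℂ Y u)
      rw [norm_sub_rev, Complex.norm_real, Real.norm_of_nonneg hp.le] at this
      linarith
    have hup : ‖d‖ * ‖inner ℂ Y u‖ ≤ ε * (‖E‖ * 2) := by
      rw [← norm_mul, hd, norm_mul, hεn]
      gcongr
      refine (norm_inner_act_le _ _ _).trans ?_
      rw [hY1, one_mul]
      gcongr
    rw [le_div_iff₀ hp]
    nlinarith [mul_le_mul_of_nonneg_left hlow (norm_nonneg d)]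
  have e : d * p - ε * inner ℂ y (act E x) =
      ε * (inner ℂ Y (act E u) - inner ℂ y (act E x)) - d * (inner ℂ Y u - p) := by
    linear_combination hd
  rw [e]
  calc _ ≤ ‖(ε : ℂ) * (inner ℂ Y (act E u) - inner ℂ y (act E x))‖ +
        ‖d * (inner ℂ Y u - p)‖ := norm_sub_le _ _
    _ ≤ ε * (3 * C * ε * ‖E‖) + 4 * ε * ‖E‖ / p * (3 * C * ε) := by
      rw [norm_mul, norm_mul, hεn]
      gcongr
    _ = _ := by ring

/-- Within the unit ball, moving from a unit matrix `D` to `Δ` loses at least `‖Δ - D‖² / 2` in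
the real inner product with `D`, and exactly that on the unit sphere. -/
theorem re_frobInner_sub {n : ℕ} {D : Mat n} (hD : ‖D‖ = 1) (Δ : Mat n) :
    (frobInner D (Δ - D)).re = (‖Δ‖ ^ 2 - 1) / 2 - ‖Δ - D‖ ^ 2 / 2 := by
  have := norm_add_sq_frobenius D (Δ - D)
  rw [add_sub_cancel, hD] at this
  linarith

/-- Taylor expansion of an analytic curve, for difference quotients. -/
theorem exists_finDiff_sub_isBigO {n : ℕ} {X : ℝ → Vec n} (hX : AnalyticAt ℝ X 0) :
    ∃ v : Vec n, (fun η => finDiff (X 0) X η - v) =O[𝓝[>] (0 : ℝ)] fun η => η := by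
  obtain ⟨q, hq⟩ := hX
  refine ⟨q 1 fun _ => 1, ?_⟩
  have h := (hq.isBigO_sub_partialSum_pow 2).mono (nhdsWithin_le_nhds (s := Set.Ioi (0 : ℝ)))
  have e : ∀ η : ℝ, q.partialSum 2 η = X 0 + η • q 1 fun _ => 1 := fun η => by
    rw [FormalMultilinearSeries.partialSum, Finset.sum_range_succ, Finset.sum_range_one,
      hq.coeff_zero]
    congr 1
    simp
  simp only [zero_add, e, Real.norm_eq_abs] at h
  have h2 : (fun η : ℝ => η⁻¹) =O[𝓝[>] (0 : ℝ)] fun η : ℝ => η⁻¹ := isBigO_refl _ _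
  refine (h2.smul h).congr' ?_ ?_
  · filter_upwards [self_mem_nhdsWithin] with η hη
    have hη : η ≠ 0 := (Set.mem_Ioi.1 hη).ne'
    rw [← sub_sub, smul_sub, inv_smul_smul₀ hη, finDiff]
    congr 1
    ext i
    simp
  · filter_upwards [self_mem_nhdsWithin] with η hη
    have hη : η ≠ 0 := (Set.mem_Ioi.1 hη).ne'
    rw [sq_abs, smul_eq_mul]
    field_simp

/-! ### Optimality of the rank-one direction up to third order -/

theorem HasBranches.eventually_norm_eigBranch_sub_le {n : ℕ} {A : Mat n} {U : Set ℝ}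
    {r : ℂ → ℝ} (hr : HasBranches A U r) (hUopen : IsOpen U) (hU0 : (0 : ℝ) ∈ U) {μ₀ : ℂ}
    (hμ : μ₀ ∈ spectrum ℂ A) (hrpos : 0 < r μ₀) {ρ : ℝ} (hρ : 0 < ρ) :
    ∀ᶠ ε in 𝓝[>] (0 : ℝ), ∀ Δ : Mat n, ‖Δ‖ ≤ 1 → ‖eigBranch A (r μ₀) μ₀ Δ ε - μ₀‖ ≤ ρ := by
  have hcont := continuousOn_ballEig μ₀ (r μ₀) A (hr.hasOneSimpleEig_self hU0 hμ)
  obtain ⟨δ, hδ, hball⟩ := Metric.continuousWithinAt_iff.1 hcont ρ hρ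
  filter_upwards [self_mem_nhdsWithin, mem_nhdsWithin_of_mem_nhds (hUopen.mem_nhds hU0),
    mem_nhdsWithin_of_mem_nhds (Iio_mem_nhds hδ)] with ε hε hεU hεδ Δ hΔ
  have hε : 0 < ε := hε
  have hd : dist (A + (ε : ℂ) • Δ) A < δ := by
    rw [dist_eq_norm, add_sub_cancel_left, norm_smul, Complex.norm_real,
      Real.norm_of_nonneg hε.le]
    exact (mul_le_of_le_one_right hε.le hΔ).trans_lt hεδ
  have := hball (hr μ₀ hμ ε hεU Δ hΔ) hd
  rw [hr.ballEig_self hU0 hμ hrpos, dist_eq_norm] at this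
  exact this.le

theorem sub_isBigO_of_analyticAt {n : ℕ} {X : ℝ → Vec n} (hX : AnalyticAt ℝ X 0) :
    (fun η => X η - X 0) =O[𝓝[>] (0 : ℝ)] fun η => η := by
  simpa using hX.differentiableAt.isBigO_sub.mono (nhdsWithin_le_nhds (s := Set.Ioi (0 : ℝ)))

section Curves

variable {n : ℕ} {A : Mat n} {U : Set ℝ} {r : ℂ → ℝ} {μ₀ : ℂ} {x y : Vec n} {X Y : ℝ → Vec n}

theorem IsNormalizedEigenpair.norm_outer_eq_one {M : Mat n} {μ : ℂ}
    (h : IsNormalizedEigenpair M μ x y) : ‖outer y x‖ = 1 := by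
  rw [norm_outer, h.norm_left, h.norm_right, one_mul]

/-- All eigenvalues `μ(ε; Δ, μ₀)` are compared with the one in direction `y x^*`, uniformly in
the unit ball of perturbations. -/
theorem HasBranches.exists_norm_eigBranch_sub_le (hr : HasBranches A U r) (hUopen : IsOpen U)
    (hU0 : (0 : ℝ) ∈ U) (hμ : μ₀ ∈ spectrum ℂ A) (hrpos : 0 < r μ₀)
    (hxy : IsNormalizedEigenpair A μ₀ x y)
    (hXY : IsEigenvectorCurves A (r μ₀) U μ₀ (outer y x) x y X Y) :
    ∃ C : ℝ, ∀ᶠ ε in 𝓝[>] (0 : ℝ), ∀ Δ : Mat n, ‖Δ‖ ≤ 1 →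
      ‖(eigBranch A (r μ₀) μ₀ Δ ε - eigBranch A (r μ₀) μ₀ (outer y x) ε) * (inner ℂ y x).re -
        ε * inner ℂ y (act (Δ - outer y x) x)‖ ≤ C * ε ^ 2 * ‖Δ - outer y x‖ := by
  obtain ⟨C₁, ρ, hC₁, hρ, hvec⟩ := hxy.exists_eigenvector_norm_sub_le
    (hr.rootMultiplicity_eq_one hU0 hμ hrpos)
  obtain ⟨C₂, hC₂⟩ := (sub_isBigO_of_analyticAt (hXY.analytic_left 0 hU0)).bound
  rw [hXY.start_left] at hC₂
  have hp := hxy.re_pos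
  have hC : 0 < max C₁ C₂ := lt_max_of_lt_left hC₁
  refine ⟨3 * max C₁ C₂ + 12 * max C₁ C₂ / (inner ℂ y x).re, ?_⟩
  have hev : ∀ a : ℝ, 0 < a → ∀ᶠ ε in 𝓝[>] (0 : ℝ), ε < a := fun a ha =>
    mem_nhdsWithin_of_mem_nhds (Iio_mem_nhds ha)
  filter_upwards [self_mem_nhdsWithin, mem_nhdsWithin_of_mem_nhds (hUopen.mem_nhds hU0), hC₂,
    hr.eventually_norm_eigBranch_sub_le hUopen hU0 hμ hrpos hρ, hev ρ hρ,
    hev (1 / max C₁ C₂) (by positivity),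
    hev ((inner ℂ y x).re / 2 / (3 * max C₁ C₂)) (by positivity)]
    with ε hε hεU hY hνρ hερ hε1 hε2 Δ hΔ
  have hε : 0 < ε := hε
  obtain ⟨u, hu, hux⟩ := hvec ε hε hερ.le Δ hΔ _ (hr μ₀ hμ ε hεU Δ hΔ).ballEig_mem.1 (hνρ Δ hΔ)
  rw [Real.norm_of_nonneg hε.le] at hY
  have hpair := hXY.eigenpair ε hεU
  rw [lt_div_iff₀ hC] at hε1
  rw [lt_div_iff₀ (by positivity)] at hε2
  refine norm_mul_sub_inner_act_le hxy.norm_right hxy.norm_left hxy.inner_eq hp hC hε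
    (by linarith) (by linarith) hpair.norm_left
    (hux.trans (by gcongr; exact le_max_left _ _))
    (hY.trans (by gcongr; exact le_max_right _ _)) ?_
  have e : act (A + (ε : ℂ) • Δ) u =
      act (A + (ε : ℂ) • outer y x) u + (ε : ℂ) • act (Δ - outer y x) u := by
    have : A + (ε : ℂ) • Δ = (A + (ε : ℂ) • outer y x) + (ε : ℂ) • (Δ - outer y x) := by
      rw [smul_sub]; abel
    rw [this]
    simp only [act, map_add, map_smul, add_apply, smul_apply]
  have := congrArg (inner ℂ (Y ε)) hu
  rw [← eigBranch_eq_ballEig, e, inner_add_right, hpair.inner_act, inner_smul_right,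
    inner_smul_right] at this
  linear_combination -this

/-- No unit perturbation beats `y x^*` by more than `O(ε³)`: a deviation `E` gains at most
`O(ε² ‖E‖)` and loses `ε ‖E‖² / 2`. -/
theorem HasBranches.maxBranch_sub_isBigO (hr : HasBranches A U r) (hUopen : IsOpen U)
    (hU0 : (0 : ℝ) ∈ U) (hμ : μ₀ ∈ spectrum ℂ A) (hrpos : 0 < r μ₀)
    (hxy : IsNormalizedEigenpair A μ₀ x y)
    (hXY : IsEigenvectorCurves A (r μ₀) U μ₀ (outer y x) x y X Y) :
    (fun ε => maxBranch A (r μ₀) ε μ₀ - (eigBranch A (r μ₀) μ₀ (outer y x) ε).re)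
      =O[𝓝[>] (0 : ℝ)] fun ε => ε ^ 3 := by
  obtain ⟨C, hC⟩ := hr.exists_norm_eigBranch_sub_le hUopen hU0 hμ hrpos hxy hXY
  have hp := hxy.re_pos
  have hD := hxy.norm_outer_eq_one
  refine IsBigO.of_bound (C ^ 2 / 2 / (inner ℂ y x).re) ?_
  filter_upwards [hC, self_mem_nhdsWithin, mem_nhdsWithin_of_mem_nhds (hUopen.mem_nhds hU0)]
    with ε hbd hε hεU
  have hε : 0 < ε := hε
  have hmax := hr.isGreatest_maxBranch hεU hμ
  have h0 : (eigBranch A (r μ₀) μ₀ (outer y x) ε).re ≤ maxBranch A (r μ₀) ε μ₀ :=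
    hmax.2 ⟨_, hD.le, rfl⟩
  obtain ⟨Δ, hΔ, hre⟩ := hmax.1
  have hΔ : ‖Δ‖ ≤ 1 := hΔ
  rw [Real.norm_of_nonneg (sub_nonneg.2 h0), Real.norm_of_nonneg (by positivity), ← hre]
  have h1 := (Complex.re_le_norm _).trans (hbd Δ hΔ)
  rw [Complex.sub_re, Complex.re_mul_ofReal, Complex.re_ofReal_mul, Complex.sub_re,
    ← frobInner_outer_left, re_frobInner_sub hD] at h1
  have h2 : ‖Δ‖ ^ 2 ≤ 1 := pow_le_one₀ (norm_nonneg _) hΔ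
  rw [div_mul_eq_mul_div, le_div_iff₀ hp]
  nlinarith [mul_nonneg hε.le (sq_nonneg (C * ε - ‖Δ - outer y x‖)),
    mul_nonneg hε.le (sub_nonneg.2 h2)]

/-- Unit perturbations within `O(ε)` of `y x^*` are optimal up to `O(ε³)`. -/
theorem HasBranches.eigBranch_sub_isBigO (hr : HasBranches A U r) (hUopen : IsOpen U)
    (hU0 : (0 : ℝ) ∈ U) (hμ : μ₀ ∈ spectrum ℂ A) (hrpos : 0 < r μ₀)
    (hxy : IsNormalizedEigenpair A μ₀ x y)
    (hXY : IsEigenvectorCurves A (r μ₀) U μ₀ (outer y x) x y X Y) {Δ : ℝ → Mat n}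
    (hΔ : ∀ᶠ ε in 𝓝[>] (0 : ℝ), ‖Δ ε‖ = 1)
    (hΔO : (fun ε => Δ ε - outer y x) =O[𝓝[>] (0 : ℝ)] fun ε => ε) :
    (fun ε => (eigBranch A (r μ₀) μ₀ (Δ ε) ε).re - (eigBranch A (r μ₀) μ₀ (outer y x) ε).re)
      =O[𝓝[>] (0 : ℝ)] fun ε => ε ^ 3 := by
  obtain ⟨C, hC⟩ := hr.exists_norm_eigBranch_sub_le hUopen hU0 hμ hrpos hxy hXY
  obtain ⟨B, hB⟩ := hΔO.bound
  have hp := hxy.re_pos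
  have hD := hxy.norm_outer_eq_one
  refine IsBigO.of_bound ((|C| * B + B ^ 2 / 2) / (inner ℂ y x).re) ?_
  filter_upwards [hC, self_mem_nhdsWithin, hΔ, hB] with ε hbd hε h1 hB
  have hε : 0 < ε := hε
  rw [Real.norm_of_nonneg hε.le] at hB
  have h2 := (Complex.abs_re_le_norm _).trans (hbd (Δ ε) h1.le)
  rw [Complex.sub_re, Complex.re_mul_ofReal, Complex.re_ofReal_mul, Complex.sub_re,
    ← frobInner_outer_left, re_frobInner_sub hD, h1] at h2
  have h3 : C * ε ^ 2 * ‖Δ ε - outer y x‖ ≤ |C| * ε ^ 2 * (B * ε) := by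
    gcongr; exact le_abs_self C
  have h4 : ε * (‖Δ ε - outer y x‖ ^ 2 / 2) ≤ ε * ((B * ε) ^ 2 / 2) := by gcongr
  have h5 : 0 ≤ ε * (‖Δ ε - outer y x‖ ^ 2 / 2) := by positivity
  rw [Real.norm_eq_abs, Real.norm_of_nonneg (by positivity), div_mul_eq_mul_div,
    le_div_iff₀ hp, ← abs_of_pos hp, ← abs_mul, abs_le]
  rw [abs_le] at h2
  have h6 : 0 ≤ |C| * ε ^ 2 * (B * ε) + ε * ((B * ε) ^ 2 / 2) := by
    have h7 : 0 ≤ |C| * ε ^ 2 * ‖Δ ε - outer y x‖ := by positivity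
    have h8 : |C| * ε ^ 2 * ‖Δ ε - outer y x‖ ≤ |C| * ε ^ 2 * (B * ε) := by gcongr
    have h9 : 0 ≤ ε * ((B * ε) ^ 2 / 2) := by positivity
    linarith
  constructor <;> nlinarith

end Curves

/-! ### Second-order expansions along the eigenvector curves -/

theorem inner_isBigO_right {n : ℕ} {l : Filter ℝ} {f : ℝ → Vec n} {g : ℝ → ℝ} (v : Vec n)
    (hf : f =O[l] g) : (fun ε => inner ℂ v (f ε)) =O[l] g :=
  (IsBigO.of_bound ‖v‖ (Eventually.of_forall fun _ => norm_inner_le_norm _ _)).trans hf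

theorem inner_isBigO_left {n : ℕ} {l : Filter ℝ} {f : ℝ → Vec n} {g : ℝ → ℝ} (v : Vec n)
    (hf : f =O[l] g) : (fun ε => inner ℂ (f ε) v) =O[l] g :=
  (IsBigO.of_bound ‖v‖ (Eventually.of_forall fun _ =>
    (norm_inner_le_norm _ _).trans_eq (mul_comm _ _))).trans hf

theorem re_isBigO {l : Filter ℝ} {f : ℝ → ℂ} {g : ℝ → ℝ} (hf : f =O[l] g) :
    (fun ε => (f ε).re) =O[l] g :=
  (IsBigO.of_bound 1 (Eventually.of_forall fun _ => by
    simpa using Complex.abs_re_le_norm _)).trans hf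

/-- Displacements of unit vectors are orthogonal to first order. -/
theorem re_inner_sub_self_right {n : ℕ} {u v : Vec n} (hu : ‖u‖ = 1) (hv : ‖v‖ = 1) :
    (inner ℂ v (u - v)).re = -(‖u - v‖ ^ 2 / 2) := by
  have := norm_add_sq (𝕜 := ℂ) v (u - v)
  rw [add_sub_cancel, hu, hv] at this
  change (1 : ℝ) ^ 2 = 1 ^ 2 + 2 * (inner ℂ v (u - v)).re + _ at this
  linarith

theorem re_inner_sub_self_left {n : ℕ} {u v : Vec n} (hu : ‖u‖ = 1) (hv : ‖v‖ = 1) :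
    (inner ℂ (u - v) v).re = -(‖u - v‖ ^ 2 / 2) := by
  rw [← re_inner_sub_self_right hu hv, ← inner_conj_symm, Complex.conj_re]

/-- Real part of `d = ε (1 + a) / (p + b)` up to third order, when `a` is imaginary to first
order. -/
theorem re_mul_sub_isBigO {d a b : ℝ → ℂ} {p : ℝ} (hp : 0 < p)
    (ha : a =O[𝓝[>] (0 : ℝ)] fun ε => ε) (hb : b =O[𝓝[>] (0 : ℝ)] fun ε => ε)
    (har : (fun ε => (a ε).re) =O[𝓝[>] (0 : ℝ)] fun ε => ε ^ 2)
    (hd : ∀ᶠ ε in 𝓝[>] (0 : ℝ), d ε * (p + b ε) = ε * (1 + a ε)) :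
    (fun ε : ℝ => (d ε).re * p - ε * (1 - (b ε).re / p))
      =O[𝓝[>] (0 : ℝ)] fun ε : ℝ => ε ^ 3 := by
  have hp' : (p : ℂ) ≠ 0 := by exact_mod_cast hp.ne'
  have hid : Tendsto (fun ε : ℝ => ε) (𝓝[>] 0) (𝓝 0) := nhdsWithin_le_nhds
  have hb0 : ∀ᶠ ε in 𝓝[>] (0 : ℝ), ‖b ε‖ < p / 2 :=
    (hb.trans_tendsto hid).norm.eventually_lt_const (by rw [norm_zero]; positivity)
  have hε : (fun ε : ℝ => (ε : ℂ)) =O[𝓝[>] (0 : ℝ)] fun ε => ε :=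
    IsBigO.of_bound 1 (Eventually.of_forall fun ε => by simp)
  have hprod : (fun ε : ℝ => ε * (b ε * (b ε * (p : ℂ)⁻¹ - a ε)))
      =O[𝓝[>] (0 : ℝ)] fun ε : ℝ => ε ^ 3 := by
    have hba : (fun ε => b ε * (p : ℂ)⁻¹ - a ε) =O[𝓝[>] (0 : ℝ)] fun ε => ε := by
      refine IsBigO.sub ?_ ha
      simpa [mul_comm] using hb.const_mul_left (p : ℂ)⁻¹
    exact (hε.mul (hb.mul hba)).congr_right fun ε => by ring
  have hq : (fun ε : ℝ => d ε * p - ε * (1 + a ε - b ε / p))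
      =O[𝓝[>] (0 : ℝ)] fun ε : ℝ => ε ^ 3 := by
    refine IsBigO.trans (IsBigO.of_bound (2 / p) ?_) hprod
    filter_upwards [hd, hb0] with ε hd hb0
    have hlow : p / 2 ≤ ‖(p : ℂ) + b ε‖ := by
      have := norm_sub_le ((p : ℂ) + b ε) (b ε)
      rw [add_sub_cancel_right, Complex.norm_real, Real.norm_of_nonneg hp.le] at this
      linarith
    have e : ε * (b ε * (b ε * (p : ℂ)⁻¹ - a ε)) =
        (d ε * p - ε * (1 + a ε - b ε / p)) * (p + b ε) := by
      rw [sub_mul, mul_right_comm, hd]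
      field_simp
      ring
    rw [e, norm_mul, div_mul_eq_mul_div, le_div_iff₀ hp]
    nlinarith [mul_le_mul_of_nonneg_left hlow
      (norm_nonneg (d ε * p - ε * (1 + a ε - b ε / p)))]
  have hεa : (fun ε : ℝ => ε * (a ε).re) =O[𝓝[>] (0 : ℝ)] fun ε : ℝ => ε ^ 3 :=
    ((isBigO_refl (fun ε : ℝ => ε) _).mul har).congr_right fun ε => by ring
  refine ((re_isBigO hq).add hεa).congr_left fun ε => ?_
  rw [Complex.sub_re, Complex.re_mul_ofReal, Complex.re_ofReal_mul, Complex.sub_re,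
    Complex.add_re, Complex.one_re, Complex.div_ofReal_re]
  ring

section Curves

variable {n : ℕ} {A : Mat n} {U : Set ℝ} {r : ℂ → ℝ} {μ₀ : ℂ} {x y : Vec n} {X Y : ℝ → Vec n}
  {h : ℝ → ℝ}

theorem tendsto_step (hpos : ∀ᶠ ε in 𝓝[>] (0 : ℝ), 0 < h ε)
    (hO : h =O[𝓝[>] (0 : ℝ)] fun ε => ε) : Tendsto h (𝓝[>] 0) (𝓝[>] 0) :=
  tendsto_nhdsWithin_iff.2 ⟨hO.trans_tendsto nhdsWithin_le_nhds, hpos⟩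

theorem finDiff_sub_finDiff_isBigO (hX : AnalyticAt ℝ X 0)
    (hpos : ∀ᶠ ε in 𝓝[>] (0 : ℝ), 0 < h ε) (hO : h =O[𝓝[>] (0 : ℝ)] fun ε => ε) :
    (fun ε => finDiff (X 0) X ε - finDiff (X 0) X (h ε)) =O[𝓝[>] (0 : ℝ)] fun ε => ε := by
  obtain ⟨v, hv⟩ := exists_finDiff_sub_isBigO hX
  have := (hv.comp_tendsto (tendsto_step hpos hO)).trans hO
  exact (hv.sub this).congr_left fun ε => by simp

theorem finDiff_isBigO_one (hX : AnalyticAt ℝ X 0)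
    (hpos : ∀ᶠ ε in 𝓝[>] (0 : ℝ), 0 < h ε) (hO : h =O[𝓝[>] (0 : ℝ)] fun ε => ε) :
    (fun ε => finDiff (X 0) X (h ε)) =O[𝓝[>] (0 : ℝ)] fun _ => (1 : ℝ) := by
  obtain ⟨v, hv⟩ := exists_finDiff_sub_isBigO hX
  have h1 := (hv.comp_tendsto (tendsto_step hpos hO)).trans hO
  have h2 : (fun ε : ℝ => ε) =O[𝓝[>] (0 : ℝ)] fun _ => (1 : ℝ) :=
    (tendsto_id.mono_left nhdsWithin_le_nhds :
      Tendsto (fun ε : ℝ => ε) (𝓝[>] 0) (𝓝 0)).isBigO_one ℝ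
  exact ((h1.trans h2).add (isBigO_const_const v one_ne_zero _)).congr_left fun ε => by simp

theorem smul_finDiff {η : ℝ} (hη : η ≠ 0) : (η : ℂ) • finDiff x X η = X η - x :=
  smul_inv_smul₀ (by exact_mod_cast hη) _

theorem IsNormalizedEigenpair.re_betaP (hxy : IsNormalizedEigenpair A μ₀ x y) (η : ℝ) :
    (betaP x y X Y η).re = -((inner ℂ (finDiff y Y η) x).re +
      (inner ℂ y (finDiff x X η)).re) / (inner ℂ y x).re := by
  rw [betaP, hxy.inner_eq, Complex.ofReal_re, ← Complex.add_re, div_mul_eq_mul_div,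
    Complex.div_ofReal_re, neg_one_mul, Complex.neg_re]

/-- Second-order expansion of `μ(ε; y x^*, μ₀)`: pairing the eigenvalue equations of the two
curves with `y` and `x` gives `μ - μ₀ = ε (x^* X) / (y^* X) = ε (Y^* y) / (Y^* x)`, and the average
of the two quotients has real part determined by `betaP`. -/
theorem IsEigenvectorCurves.eigBranch_sub_isBigO (hUopen : IsOpen U)
    (hU0 : (0 : ℝ) ∈ U) (hxy : IsNormalizedEigenpair A μ₀ x y)
    (hXY : IsEigenvectorCurves A (r μ₀) U μ₀ (outer y x) x y X Y)
    (hpos : ∀ᶠ ε in 𝓝[>] (0 : ℝ), 0 < h ε) (hO : h =O[𝓝[>] (0 : ℝ)] fun ε => ε) :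
    (fun ε => (eigBranch A (r μ₀) μ₀ (outer y x) ε).re -
      (μ₀.re + ε / (inner ℂ y x).re * (1 + ε / 2 * (betaP x y X Y (h ε)).re)))
      =O[𝓝[>] (0 : ℝ)] fun ε => ε ^ 3 := by
  have hp := hxy.re_pos
  have hyx := hxy.inner_eq
  have hre := hxy.re_betaP (X := X) (Y := Y)
  generalize (inner ℂ y x).re = p at hp hyx hre ⊢
  have hU : ∀ᶠ ε in 𝓝[>] (0 : ℝ), ε ∈ U := mem_nhdsWithin_of_mem_nhds (hUopen.mem_nhds hU0)
  have hXO := sub_isBigO_of_analyticAt (hXY.analytic_right 0 hU0)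
  have hYO := sub_isBigO_of_analyticAt (hXY.analytic_left 0 hU0)
  have hXd := finDiff_sub_finDiff_isBigO (hXY.analytic_right 0 hU0) hpos hO
  have hYd := finDiff_sub_finDiff_isBigO (hXY.analytic_left 0 hU0) hpos hO
  rw [hXY.start_right] at hXO hXd
  rw [hXY.start_left] at hYO hYd
  have hxx : inner ℂ x x = (1 : ℂ) := by
    rw [inner_self_eq_norm_sq_to_K, hxy.norm_right]; simp
  have hyy : inner ℂ y y = (1 : ℂ) := by
    rw [inner_self_eq_norm_sq_to_K, hxy.norm_left]; simp
  have hright : (fun ε : ℝ => (eigBranch A (r μ₀) μ₀ (outer y x) ε - μ₀).re * p -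
      ε * (1 - (inner ℂ y (X ε - x)).re / p)) =O[𝓝[>] (0 : ℝ)] fun ε : ℝ => ε ^ 3 := by
    refine re_mul_sub_isBigO (a := fun ε => inner ℂ x (X ε - x)) hp
      (inner_isBigO_right x hXO) (inner_isBigO_right y hXO) ?_ ?_
    · refine IsBigO.congr' ((hXO.norm_left.pow 2).const_mul_left (-1 / 2)) ?_ EventuallyEq.rfl
      filter_upwards [hU] with ε hε
      rw [re_inner_sub_self_right (hXY.eigenpair ε hε).norm_right hxy.norm_right]
      ring
    · filter_upwards [hU] with ε hε
      have := congrArg (inner ℂ y) (hXY.eigenpair ε hε).act_right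
      simp only [act, map_add, map_smul, add_apply, smul_apply] at this
      rw [inner_add_right, inner_smul_right, inner_smul_right, hxy.inner_act, ← act, act_outer,
        inner_smul_right, hyy] at this
      rw [inner_sub_right, inner_sub_right, hxx, hyx]
      linear_combination -this
  have hleft : (fun ε : ℝ => (eigBranch A (r μ₀) μ₀ (outer y x) ε - μ₀).re * p -
      ε * (1 - (inner ℂ (Y ε - y) x).re / p)) =O[𝓝[>] (0 : ℝ)] fun ε : ℝ => ε ^ 3 := by
    refine re_mul_sub_isBigO (a := fun ε => inner ℂ (Y ε - y) y) hp
      (inner_isBigO_left y hYO) (inner_isBigO_left x hYO) ?_ ?_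
    · refine IsBigO.congr' ((hYO.norm_left.pow 2).const_mul_left (-1 / 2)) ?_ EventuallyEq.rfl
      filter_upwards [hU] with ε hε
      rw [re_inner_sub_self_left (hXY.eigenpair ε hε).norm_left hxy.norm_left]
      ring
    · filter_upwards [hU] with ε hε
      have := (hXY.eigenpair ε hε).inner_act x
      simp only [act, map_add, map_smul, add_apply, smul_apply] at this
      rw [inner_add_right, inner_smul_right, ← act, ← act, hxy.act_right, act_outer, hxx,
        one_smul, inner_smul_right] at this
      rw [inner_sub_left, inner_sub_left, hyy, hyx]
      linear_combination -this
  have hquot : (fun ε : ℝ => ε * (ε * ((inner ℂ y (finDiff x X ε - finDiff x X (h ε))).re +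
      (inner ℂ (finDiff y Y ε - finDiff y Y (h ε)) x).re))) =O[𝓝[>] (0 : ℝ)]
        fun ε : ℝ => ε ^ 3 :=
    ((isBigO_refl (fun ε : ℝ => ε) _).mul ((isBigO_refl (fun ε : ℝ => ε) _).mul
      ((re_isBigO (inner_isBigO_right y hXd)).add
        (re_isBigO (inner_isBigO_left x hYd))))).congr_right fun ε => by ring
  refine IsBigO.congr' (((hright.add hleft).const_mul_left (1 / (2 * p))).sub
    (hquot.const_mul_left (1 / (2 * p ^ 2)))) ?_ EventuallyEq.rfl
  filter_upwards [self_mem_nhdsWithin] with ε hε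
  have hε : ε ≠ 0 := (Set.mem_Ioi.1 hε).ne'
  rw [hre, ← smul_finDiff hε, ← smul_finDiff hε, inner_smul_right, inner_smul_left,
    Complex.conj_ofReal, Complex.re_ofReal_mul, Complex.re_ofReal_mul, inner_sub_right,
    inner_sub_left, Complex.sub_re, Complex.sub_re, Complex.sub_re]
  field_simp
  ring

theorem betaP_isBigO_one (hX : AnalyticAt ℝ X 0) (hY : AnalyticAt ℝ Y 0)
    (hpos : ∀ᶠ ε in 𝓝[>] (0 : ℝ), 0 < h ε) (hO : h =O[𝓝[>] (0 : ℝ)] fun ε => ε) :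
    (fun ε => betaP (X 0) (Y 0) X Y (h ε)) =O[𝓝[>] (0 : ℝ)] fun _ => (1 : ℝ) :=
  ((inner_isBigO_left (X 0) (finDiff_isBigO_one hY hpos hO)).add
    (inner_isBigO_right (Y 0) (finDiff_isBigO_one hX hpos hO))).const_mul_left _

theorem correction_isBigO_one (hX : AnalyticAt ℝ X 0) (hY : AnalyticAt ℝ Y 0)
    (hpos : ∀ᶠ ε in 𝓝[>] (0 : ℝ), 0 < h ε) (hO : h =O[𝓝[>] (0 : ℝ)] fun ε => ε) :
    (fun ε => outer (finDiff (Y 0) Y (h ε)) (X 0) + outer (Y 0) (finDiff (X 0) X (h ε)) +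
      betaP (X 0) (Y 0) X Y (h ε) • outer (Y 0) (X 0)) =O[𝓝[>] (0 : ℝ)] fun _ => (1 : ℝ) := by
  refine IsBigO.add (IsBigO.add ?_ ?_) ?_
  · refine (IsBigO.of_bound ‖X 0‖ (Eventually.of_forall fun ε => ?_)).trans
      (finDiff_isBigO_one hY hpos hO)
    rw [norm_outer, mul_comm]
  · refine (IsBigO.of_bound ‖Y 0‖ (Eventually.of_forall fun ε => ?_)).trans
      (finDiff_isBigO_one hX hpos hO)
    rw [norm_outer]
  · refine (IsBigO.of_bound ‖outer (Y 0) (X 0)‖ (Eventually.of_forall fun ε => ?_)).trans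
      (betaP_isBigO_one hX hY hpos hO)
    rw [norm_smul, mul_comm]

theorem IsEigenvectorCurves.corrected_sub_isBigO (hU0 : (0 : ℝ) ∈ U)
    (hXY : IsEigenvectorCurves A (r μ₀) U μ₀ (outer y x) x y X Y)
    (hpos : ∀ᶠ ε in 𝓝[>] (0 : ℝ), 0 < h ε) (hO : h =O[𝓝[>] (0 : ℝ)] fun ε => ε) :
    (fun ε => corrected x y X Y ε (h ε) - outer y x) =O[𝓝[>] (0 : ℝ)] fun ε => ε := by
  have hK := correction_isBigO_one (hXY.analytic_right 0 hU0) (hXY.analytic_left 0 hU0) hpos hO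
  rw [hXY.start_right, hXY.start_left] at hK
  have hε : (fun ε : ℝ => (ε : ℂ) / 2) =O[𝓝[>] (0 : ℝ)] fun ε => ε :=
    IsBigO.of_bound 1 (Eventually.of_forall fun ε => by
      rw [norm_div, Complex.norm_real, Complex.norm_ofNat]
      linarith [norm_nonneg ε])
  refine (hε.smul hK).congr (fun ε => ?_) fun ε => by simp
  rw [corrected, add_sub_cancel_left]

theorem IsEigenvectorCurves.eventually_corrected_ne_zero (hU0 : (0 : ℝ) ∈ U)
    (hxy : IsNormalizedEigenpair A μ₀ x y)
    (hXY : IsEigenvectorCurves A (r μ₀) U μ₀ (outer y x) x y X Y)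
    (hpos : ∀ᶠ ε in 𝓝[>] (0 : ℝ), 0 < h ε) (hO : h =O[𝓝[>] (0 : ℝ)] fun ε => ε) :
    ∀ᶠ ε in 𝓝[>] (0 : ℝ), corrected x y X Y ε (h ε) ≠ 0 := by
  have hlim : Tendsto (fun ε => corrected x y X Y ε (h ε) - outer y x) (𝓝[>] 0) (𝓝 0) :=
    (hXY.corrected_sub_isBigO hU0 hpos hO).trans_tendsto nhdsWithin_le_nhds
  filter_upwards [hlim.norm.eventually_lt_const (u := 1) (by simp)] with ε hε h0
  rw [h0, zero_sub, norm_neg, hxy.norm_outer_eq_one] at hε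
  exact lt_irrefl _ hε

theorem norm_nearOpt {ε η : ℝ} (h0 : corrected x y X Y ε η ≠ 0) : ‖nearOpt x y X Y ε η‖ = 1 := by
  rw [nearOpt, norm_smul, norm_inv, Complex.norm_real, norm_norm]
  exact inv_mul_cancel₀ (norm_ne_zero_iff.2 h0)

theorem IsEigenvectorCurves.nearOpt_sub_isBigO (hU0 : (0 : ℝ) ∈ U)
    (hxy : IsNormalizedEigenpair A μ₀ x y)
    (hXY : IsEigenvectorCurves A (r μ₀) U μ₀ (outer y x) x y X Y)
    (hpos : ∀ᶠ ε in 𝓝[>] (0 : ℝ), 0 < h ε) (hO : h =O[𝓝[>] (0 : ℝ)] fun ε => ε) :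
    (fun ε => nearOpt x y X Y ε (h ε) - outer y x) =O[𝓝[>] (0 : ℝ)] fun ε => ε := by
  have hG := hXY.corrected_sub_isBigO hU0 hpos hO
  refine IsBigO.trans (IsBigO.of_bound 2 ?_) hG
  filter_upwards [hXY.eventually_corrected_ne_zero hU0 hxy hpos hO] with ε h0
  have hn : ‖corrected x y X Y ε (h ε)‖ ≠ 0 := norm_ne_zero_iff.2 h0
  -- Normalization moves `G` by the distance of its norm from one.
  have h1 : ‖nearOpt x y X Y ε (h ε) - corrected x y X Y ε (h ε)‖ ≤
      ‖corrected x y X Y ε (h ε) - outer y x‖ := by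
    have e : nearOpt x y X Y ε (h ε) - corrected x y X Y ε (h ε) =
        ((1 - ‖corrected x y X Y ε (h ε)‖ : ℝ) : ℂ) • nearOpt x y X Y ε (h ε) := by
      have : corrected x y X Y ε (h ε) =
          (‖corrected x y X Y ε (h ε)‖ : ℂ) • nearOpt x y X Y ε (h ε) := by
        rw [nearOpt, smul_inv_smul₀ (by exact_mod_cast hn)]
      conv_lhs => rw [this]
      rw [Complex.ofReal_sub, sub_smul, Complex.ofReal_one, one_smul, ← this]
    rw [e, norm_smul, norm_nearOpt h0, mul_one, Complex.norm_real, Real.norm_eq_abs, abs_sub_comm]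
    have := abs_norm_sub_norm_le (corrected x y X Y ε (h ε)) (outer y x)
    rwa [hxy.norm_outer_eq_one] at this
  have h2 := norm_sub_le_norm_sub_add_norm_sub (nearOpt x y X Y ε (h ε))
    (corrected x y X Y ε (h ε)) (outer y x)
  linarith

/-- The pairing in `secondOrder` is the norm of `corrected`, also in the degenerate case of a zero
matrix. -/
theorem frobInner_corrected_nearOpt (ε η : ℝ) :
    (frobInner (corrected x y X Y ε η) (nearOpt x y X Y ε η)).re = ‖corrected x y X Y ε η‖ := by
  rw [nearOpt, frobInner_smul_right, frobInner_self, ← Complex.ofReal_inv, ← Complex.ofReal_mul,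
    Complex.ofReal_re, sq]
  by_cases h0 : ‖corrected x y X Y ε η‖ = 0
  · rw [h0]; simp
  · exact inv_mul_cancel_left₀ h0 _

/-- The real part of the pairing of `y x^*` with the correction is that of `betaP` up to `O(ε)`,
because the difference quotients of the unit vectors are orthogonal to them to first order. -/
theorem IsEigenvectorCurves.frobInner_sub_isBigO (hUopen : IsOpen U) (hU0 : (0 : ℝ) ∈ U)
    (hxy : IsNormalizedEigenpair A μ₀ x y)
    (hXY : IsEigenvectorCurves A (r μ₀) U μ₀ (outer y x) x y X Y)
    (hpos : ∀ᶠ ε in 𝓝[>] (0 : ℝ), 0 < h ε) (hO : h =O[𝓝[>] (0 : ℝ)] fun ε => ε) :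
    (fun ε => (frobInner (outer y x) (outer (finDiff y Y (h ε)) x + outer y (finDiff x X (h ε)) +
      betaP x y X Y (h ε) • outer y x)).re - (betaP x y X Y (h ε)).re)
      =O[𝓝[>] (0 : ℝ)] fun ε => ε := by
  have hXb := finDiff_isBigO_one (hXY.analytic_right 0 hU0) hpos hO
  have hYb := finDiff_isBigO_one (hXY.analytic_left 0 hU0) hpos hO
  rw [hXY.start_right] at hXb
  rw [hXY.start_left] at hYb
  have hxx : inner ℂ x x = (1 : ℂ) := by
    rw [inner_self_eq_norm_sq_to_K, hxy.norm_right]; simp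
  have hyy : inner ℂ y y = (1 : ℂ) := by
    rw [inner_self_eq_norm_sq_to_K, hxy.norm_left]; simp
  have key : (fun ε => -1 / 2 * (h ε * (‖finDiff y Y (h ε)‖ ^ 2 + ‖finDiff x X (h ε)‖ ^ 2)))
      =O[𝓝[>] (0 : ℝ)] fun ε => ε :=
    ((hO.mul ((hYb.norm_left.pow 2).add (hXb.norm_left.pow 2))).const_mul_left
      (-1 / 2)).congr_right fun ε => by ring
  refine key.congr' ?_ EventuallyEq.rfl
  filter_upwards [hpos, (tendsto_step hpos hO).eventually
    (mem_nhdsWithin_of_mem_nhds (hUopen.mem_nhds hU0))] with ε hh hhU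
  have hpair := hXY.eigenpair _ hhU
  have hscale : ∀ (v : Vec n) (Z : ℝ → Vec n), ‖v‖ = 1 → ‖Z (h ε)‖ = 1 →
      (inner ℂ v (finDiff v Z (h ε))).re = -1 / 2 * (h ε * ‖finDiff v Z (h ε)‖ ^ 2) := by
    intro v Z hv hZ
    have e := re_inner_sub_self_right hZ hv
    rw [← smul_finDiff hh.ne', inner_smul_right, Complex.re_ofReal_mul, norm_smul,
      Complex.norm_real, Real.norm_of_nonneg hh.le] at e
    apply mul_left_cancel₀ hh.ne'
    rw [e]; ring
  have e1 := hscale x X hxy.norm_right hpair.norm_right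
  have e2 := hscale y Y hxy.norm_left hpair.norm_left
  rw [frobInner_add_right, frobInner_add_right, frobInner_smul_right, frobInner_outer_left,
    frobInner_outer_left, frobInner_outer_left, act_outer, act_outer, act_outer, hxx, one_smul,
    one_smul, hyy, inner_smul_right, hyy, mul_one, mul_one, Complex.add_re, Complex.add_re,
    ← inner_conj_symm (finDiff x X (h ε)) x, Complex.conj_re, e1, e2]
  ring

/-- The Frobenius norm of `corrected` up to second order. -/
theorem IsEigenvectorCurves.norm_corrected_sub_isBigO (hUopen : IsOpen U) (hU0 : (0 : ℝ) ∈ U)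
    (hxy : IsNormalizedEigenpair A μ₀ x y)
    (hXY : IsEigenvectorCurves A (r μ₀) U μ₀ (outer y x) x y X Y)
    (hpos : ∀ᶠ ε in 𝓝[>] (0 : ℝ), 0 < h ε) (hO : h =O[𝓝[>] (0 : ℝ)] fun ε => ε) :
    (fun ε => ‖corrected x y X Y ε (h ε)‖ - (1 + ε / 2 * (betaP x y X Y (h ε)).re))
      =O[𝓝[>] (0 : ℝ)] fun ε => ε ^ 2 := by
  have hG := hXY.corrected_sub_isBigO hU0 hpos hO
  -- With `t = ‖G‖` one has `t - 1 = (t² - 1) / 2 - (t - 1)² / 2`, and `t²` expands exactly.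
  have hin := hXY.frobInner_sub_isBigO hUopen hU0 hxy hpos hO
  have hD := hxy.norm_outer_eq_one
  have hnorm : (fun ε => ‖corrected x y X Y ε (h ε)‖ - 1) =O[𝓝[>] (0 : ℝ)] fun ε => ε := by
    refine IsBigO.trans (IsBigO.of_bound 1 (Eventually.of_forall fun ε => ?_)) hG
    have := abs_norm_sub_norm_le (corrected x y X Y ε (h ε)) (outer y x)
    rwa [hD, ← Real.norm_eq_abs, ← one_mul ‖corrected x y X Y ε (h ε) - outer y x‖] at this
  have h1 := ((isBigO_refl (fun ε : ℝ => ε) (𝓝[>] 0)).mul hin).const_mul_left (1 / 2)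
  have h2 := (hG.norm_left.pow 2).const_mul_left (1 / 2)
  have h3 := (hnorm.pow 2).const_mul_left (1 / 2)
  refine ((h1.congr_right fun ε => (sq ε).symm).add (h2.sub h3)).congr_left fun ε => ?_
  have e := norm_add_sq_frobenius (outer y x) (corrected x y X Y ε (h ε) - outer y x)
  have hc : corrected x y X Y ε (h ε) - outer y x = ((ε : ℂ) / 2) •
      (outer (finDiff y Y (h ε)) x + outer y (finDiff x X (h ε)) +
        betaP x y X Y (h ε) • outer y x) := by
    rw [corrected, add_sub_cancel_left]
  have hr : (frobInner (outer y x) (corrected x y X Y ε (h ε) - outer y x)).re =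
      ε / 2 * (frobInner (outer y x) (outer (finDiff y Y (h ε)) x +
        outer y (finDiff x X (h ε)) + betaP x y X Y (h ε) • outer y x)).re := by
    rw [hc, frobInner_smul_right, ← Complex.re_ofReal_mul]
    push_cast
    rfl
  rw [add_sub_cancel, hD, hr] at e
  linear_combination (-1 / 2) * e

theorem IsEigenvectorCurves.secondOrder_sub_isBigO (hUopen : IsOpen U) (hU0 : (0 : ℝ) ∈ U)
    (hxy : IsNormalizedEigenpair A μ₀ x y)
    (hXY : IsEigenvectorCurves A (r μ₀) U μ₀ (outer y x) x y X Y)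
    (hpos : ∀ᶠ ε in 𝓝[>] (0 : ℝ), 0 < h ε) (hO : h =O[𝓝[>] (0 : ℝ)] fun ε => ε) :
    (fun ε => secondOrder μ₀ x y X Y ε (h ε) - (eigBranch A (r μ₀) μ₀ (outer y x) ε).re)
      =O[𝓝[>] (0 : ℝ)] fun ε => ε ^ 3 := by
  have h1 := ((isBigO_refl (fun ε : ℝ => ε) (𝓝[>] 0)).mul
    (hXY.norm_corrected_sub_isBigO hUopen hU0 hxy hpos hO)).const_mul_left
      (1 / (inner ℂ y x).re)
  have h2 := hXY.eigBranch_sub_isBigO hUopen hU0 hxy hpos hO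
  refine ((h1.congr_right fun ε => by ring).sub h2).congr_left fun ε => ?_
  rw [secondOrder, frobInner_corrected_nearOpt]
  ring

end Curves

/-! ### Maxima over the eigenvalues -/

theorem maxEig_sub_isBigO {n : ℕ} (hn : 1 ≤ n) {A : Mat n} {l : Filter ℝ} {k : ℝ → ℝ}
    {f g : ℝ → ℂ → ℝ} (hfg : ∀ z ∈ spectrum ℂ A, (fun ε => f ε z - g ε z) =O[l] k) :
    (fun ε => maxEig A (f ε) - maxEig A (g ε)) =O[l] k := by
  have hfin : (spectrum ℂ A).Finite := Matrix.finite_spectrum A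
  have hsum : (fun ε => ∑ z ∈ hfin.toFinset, ‖f ε z - g ε z‖) =O[l] k :=
    IsBigO.fun_sum fun z hz => (hfg z (hfin.mem_toFinset.1 hz)).norm_left
  refine IsBigO.trans (IsBigO.of_bound 1 (Eventually.of_forall fun ε => ?_)) hsum
  have hterm : ∀ z ∈ spectrum ℂ A,
      |f ε z - g ε z| ≤ ∑ z ∈ hfin.toFinset, ‖f ε z - g ε z‖ := fun z hz =>
    Finset.single_le_sum (f := fun z => ‖f ε z - g ε z‖) (fun _ _ => norm_nonneg _)
      (hfin.mem_toFinset.2 hz)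
  obtain ⟨⟨zf, hzf, ef⟩, hf⟩ := isGreatest_maxEig hn A (f ε)
  obtain ⟨⟨zg, hzg, eg⟩, hg⟩ := isGreatest_maxEig hn A (g ε)
  have h1 := hf ⟨zg, hzg, rfl⟩
  have h2 := hg ⟨zf, hzf, rfl⟩
  have h3 := abs_le.1 (hterm zf hzf)
  have h4 := abs_le.1 (hterm zg hzg)
  rw [one_mul, Real.norm_eq_abs]
  refine (abs_le.2 ⟨?_, ?_⟩).trans (le_abs_self _) <;> linarith

theorem HasBranches.psAbscissa_eq {n : ℕ} (hn : 1 ≤ n) {A : Mat n} {U : Set ℝ} {r : ℂ → ℝ}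
    (hr : HasBranches A U r) (hrpos : ∀ μ₀ ∈ spectrum ℂ A, 0 < r μ₀) {ε : ℝ} (hε : 0 < ε)
    (hU : Set.Icc 0 ε ⊆ U) :
    psAbscissa ε A = maxEig A fun μ₀ => maxBranch A (r μ₀) ε μ₀ :=
  (hr.isGreatest_maxEig_maxBranch hn hrpos hε hU).csSup_eq

/-- The spectral abscissa of an admissible perturbation of `A` dominates the branch eigenvalue, and
is dominated by the pseudospectral abscissa. -/
theorem HasBranches.maxEig_spectralAbscissa_mem_Icc {n : ℕ} (hn : 1 ≤ n) {A : Mat n} {U : Set ℝ}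
    {r : ℂ → ℝ} (hr : HasBranches A U r) (hrpos : ∀ μ₀ ∈ spectrum ℂ A, 0 < r μ₀) {ε : ℝ}
    (hε : 0 < ε) (hU : Set.Icc 0 ε ⊆ U) {Δ : ℂ → Mat n}
    (hΔ : ∀ μ₀ ∈ spectrum ℂ A, ‖Δ μ₀‖ ≤ 1) :
    (maxEig A fun μ₀ => spectralAbscissa (A + (ε : ℂ) • Δ μ₀)) ∈
      Set.Icc (maxEig A fun μ₀ => (eigBranch A (r μ₀) μ₀ (Δ μ₀) ε).re) (psAbscissa ε A) := by
  have hεU : ε ∈ U := hU ⟨hε.le, le_rfl⟩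
  obtain ⟨⟨z₁, hz₁, e₁⟩, h₁⟩ :=
    isGreatest_maxEig hn A fun μ₀ => spectralAbscissa (A + (ε : ℂ) • Δ μ₀)
  obtain ⟨⟨z₂, hz₂, e₂⟩, -⟩ :=
    isGreatest_maxEig hn A fun μ₀ => (eigBranch A (r μ₀) μ₀ (Δ μ₀) ε).re
  constructor
  · rw [← e₂]
    refine le_trans ?_ (h₁ ⟨z₂, hz₂, rfl⟩)
    exact (isGreatest_maxEig hn (A + (ε : ℂ) • Δ z₂) Complex.re).2
      ⟨_, (hr z₂ hz₂ ε hεU _ (hΔ z₂ hz₂)).ballEig_mem.1, rfl⟩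
  · rw [← e₁]
    obtain ⟨⟨w, hw, e⟩, -⟩ := isGreatest_maxEig hn (A + (ε : ℂ) • Δ z₁) Complex.re
    change maxEig (A + (ε : ℂ) • Δ z₁) Complex.re ≤ _
    rw [← e, hr.psAbscissa_eq hn hrpos hε hU]
    exact (hr.isGreatest_maxEig_maxBranch hn hrpos hε hU).2
      ⟨w, (mem_pseudospectrum_iff hε).2 ⟨_, hΔ z₁ hz₁, hw⟩, rfl⟩

end PsaMatrix

end

theorem mainTheorem3 (n : ℕ) (hn : 1 ≤ n) (A : PsaMatrix.Mat n)
    -- an open interval `U` around `0` and radii `r(μ₀)` as in the uniqueness condition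
    (U : Set ℝ) (hUopen : IsOpen U) (hUint : U.OrdConnected) (hU0 : (0 : ℝ) ∈ U)
    (r : ℂ → ℝ) (hrpos : ∀ μ₀ ∈ spectrum ℂ A, 0 < r μ₀)
    (hr : ∀ μ₀ ∈ spectrum ℂ A, ∀ η ∈ U, ∀ Δ : PsaMatrix.Mat n, ‖Δ‖ ≤ 1 →
      PsaMatrix.HasOneSimpleEig (A + (η : ℂ) • Δ) μ₀ (r μ₀))
    -- normalized eigenvectors `x μ₀`, `y μ₀` of `A`
    (x y : ℂ → PsaMatrix.Vec n)
    (hxy : ∀ μ₀ ∈ spectrum ℂ A, PsaMatrix.IsNormalizedEigenpair A μ₀ (x μ₀) (y μ₀))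
    -- analytic normalized eigenvectors of `A + η y x^*`
    (X Y : ℂ → ℝ → PsaMatrix.Vec n)
    (hXY : ∀ μ₀ ∈ spectrum ℂ A,
      PsaMatrix.IsEigenvectorCurves A (r μ₀) U μ₀ (PsaMatrix.outer (y μ₀) (x μ₀))
        (x μ₀) (y μ₀) (X μ₀) (Y μ₀))
    -- the finite-difference step `h = h(ε)`, positive and `O(ε)`
    (h : ℝ → ℝ) (hpos : ∀ᶠ ε in 𝓝[>] (0 : ℝ), 0 < h ε)
    (hO : h =O[𝓝[>] (0 : ℝ)] fun ε => ε) :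
    -- all maxima are attained and the first identity is exact whenever `[0, ε] ⊆ U`
    (∀ ε : ℝ, 0 < ε → Set.Icc 0 ε ⊆ U →
      IsGreatest (Complex.re '' PsaMatrix.pseudospectrum ε A) (PsaMatrix.psAbscissa ε A) ∧
      (∀ μ₀ ∈ spectrum ℂ A, IsGreatest (PsaMatrix.attainable A (r μ₀) ε μ₀)
        (PsaMatrix.maxBranch A (r μ₀) ε μ₀)) ∧
      PsaMatrix.psAbscissa ε A =
        PsaMatrix.maxEig A fun μ₀ => PsaMatrix.maxBranch A (r μ₀) ε μ₀) ∧
    -- the near-optimal perturbations are well defined for small `ε`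
    (∀ᶠ ε in 𝓝[>] (0 : ℝ), h ε ∈ U ∧ ∀ μ₀ ∈ spectrum ℂ A,
      PsaMatrix.corrected (x μ₀) (y μ₀) (X μ₀) (Y μ₀) ε (h ε) ≠ 0) ∧
    -- the three second-order approximations
    ((fun ε => PsaMatrix.psAbscissa ε A - PsaMatrix.maxEig A fun μ₀ =>
        (PsaMatrix.eigBranch A (r μ₀) μ₀
          (PsaMatrix.nearOpt (x μ₀) (y μ₀) (X μ₀) (Y μ₀) ε (h ε)) ε).re)
      =O[𝓝[>] (0 : ℝ)] fun ε => ε ^ 3) ∧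
    ((fun ε => PsaMatrix.psAbscissa ε A - PsaMatrix.maxEig A fun μ₀ =>
        PsaMatrix.spectralAbscissa
          (A + (ε : ℂ) • PsaMatrix.nearOpt (x μ₀) (y μ₀) (X μ₀) (Y μ₀) ε (h ε)))
      =O[𝓝[>] (0 : ℝ)] fun ε => ε ^ 3) ∧
    ((fun ε => PsaMatrix.psAbscissa ε A - PsaMatrix.maxEig A fun μ₀ =>
        PsaMatrix.secondOrder μ₀ (x μ₀) (y μ₀) (X μ₀) (Y μ₀) ε (h ε))
      =O[𝓝[>] (0 : ℝ)] fun ε => ε ^ 3) := by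
  have hB : PsaMatrix.HasBranches A U r := hr
  have hev : ∀ᶠ ε in 𝓝[>] (0 : ℝ), Set.Icc 0 ε ⊆ U := by
    filter_upwards [mem_nhdsWithin_of_mem_nhds (hUopen.mem_nhds hU0)] with ε hε
    exact hUint.out hU0 hε
  have hne : ∀ᶠ ε in 𝓝[>] (0 : ℝ), ∀ μ₀ ∈ spectrum ℂ A,
      PsaMatrix.corrected (x μ₀) (y μ₀) (X μ₀) (Y μ₀) ε (h ε) ≠ 0 :=
    (Filter.eventually_all_finite (Matrix.finite_spectrum A)).2 fun μ₀ hμ =>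
      (hXY μ₀ hμ).eventually_corrected_ne_zero hU0 (hxy μ₀ hμ) hpos hO
  have hmax := fun μ₀ (hμ : μ₀ ∈ spectrum ℂ A) =>
    hB.maxBranch_sub_isBigO hUopen hU0 hμ (hrpos μ₀ hμ) (hxy μ₀ hμ) (hXY μ₀ hμ)
  have hps : ∀ g : ℝ → ℂ → ℝ,
      (∀ μ₀ ∈ spectrum ℂ A, (fun ε => PsaMatrix.maxBranch A (r μ₀) ε μ₀ - g ε μ₀)
        =O[𝓝[>] (0 : ℝ)] fun ε => ε ^ 3) →
      (fun ε => PsaMatrix.psAbscissa ε A - PsaMatrix.maxEig A (g ε))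
        =O[𝓝[>] (0 : ℝ)] fun ε => ε ^ 3 := by
    intro g hg
    refine (PsaMatrix.maxEig_sub_isBigO hn hg).congr' ?_ EventuallyEq.rfl
    filter_upwards [hev, self_mem_nhdsWithin] with ε hε hε0
    rw [hB.psAbscissa_eq hn hrpos hε0 hε]
  have hbranch : (fun ε => PsaMatrix.psAbscissa ε A - PsaMatrix.maxEig A fun μ₀ =>
      (PsaMatrix.eigBranch A (r μ₀) μ₀
        (PsaMatrix.nearOpt (x μ₀) (y μ₀) (X μ₀) (Y μ₀) ε (h ε)) ε).re)
      =O[𝓝[>] (0 : ℝ)] fun ε => ε ^ 3 := by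
    refine hps _ fun μ₀ hμ => ?_
    refine ((hmax μ₀ hμ).sub (hB.eigBranch_sub_isBigO hUopen hU0 hμ (hrpos μ₀ hμ) (hxy μ₀ hμ)
        (hXY μ₀ hμ) ?_ ((hXY μ₀ hμ).nearOpt_sub_isBigO hU0 (hxy μ₀ hμ) hpos hO))).congr_left
          fun ε => by rw [sub_sub_sub_cancel_right]
    exact hne.mono fun ε hε => PsaMatrix.norm_nearOpt (hε μ₀ hμ)
  refine ⟨fun ε hε hεU => ⟨?_, fun μ₀ hμ => hB.isGreatest_maxBranch (hεU ⟨hε.le, le_rfl⟩) hμ,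
    hB.psAbscissa_eq hn hrpos hε hεU⟩, ?_, hbranch, ?_, ?_⟩
  · rw [hB.psAbscissa_eq hn hrpos hε hεU]
    exact hB.isGreatest_maxEig_maxBranch hn hrpos hε hεU
  · exact ((PsaMatrix.tendsto_step hpos hO).eventually
      (mem_nhdsWithin_of_mem_nhds (hUopen.mem_nhds hU0))).and hne
  · refine IsBigO.trans (IsBigO.of_bound 1 ?_) hbranch
    filter_upwards [hev, hne, self_mem_nhdsWithin] with ε hε h0 hε0
    have hmem := hB.maxEig_spectralAbscissa_mem_Icc hn hrpos hε0 hε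
      (Δ := fun μ₀ => PsaMatrix.nearOpt (x μ₀) (y μ₀) (X μ₀) (Y μ₀) ε (h ε))
      fun μ₀ hμ => (PsaMatrix.norm_nearOpt (h0 μ₀ hμ)).le
    rw [one_mul, Real.norm_of_nonneg (sub_nonneg.2 hmem.2),
      Real.norm_of_nonneg (sub_nonneg.2 (hmem.1.trans hmem.2))]
    exact sub_le_sub_left hmem.1 _
  · exact hps _ fun μ₀ hμ =>
      ((hmax μ₀ hμ).sub ((hXY μ₀ hμ).secondOrder_sub_isBigO hUopen hU0 (hxy μ₀ hμ)
        hpos hO)).congr_left fun ε => by rw [sub_sub_sub_cancel_right]
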